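/- **Setting.** For a potential $V:(0,\infty)\to\mathbb R$ let $P$ be the planar one-centre problem $\ddot u=\nabla V(|u|)$, $(u(0),\dot u(0))=\nu=(q_0,p_0)\in(\mathbb R^2\setminus\{0\})\times\mathbb R^2$, whose classical solutions $u_\nu(t)$ avoid the origin. For $\varepsilon>0$ put $V_\varepsilon(x)=V(\sqrt{x^2+\varepsilon^2})$ and let $u_{\varepsilon,\nu}$ be the solution of $\ddot u=\nabla V_\varepsilon(|u|)$ with initial datum $\nu$. Let $\bar R=\min\{T,S\}\in[0,\infty]$, where $S$ is the supremum of the radii such that $V'<0$, $V''>0$ and $V'/V''$ is decreasing on $(0,S)$, and $T$ is the supremum of the radii such that $V'(x)/V''(x)\le -x/2$ on $(0,T)$. Let $S(V)$ be the set of data $\bar\nu=(\bar q,\bar p)$, $\bar q\neq0$, $|\bar q|\le\bar R$, whose classical solution $\bar u$ stays in the closed ball of radius $\bar R$ about $0$ and tends to $0$ as $t\to T_0^-$, for some collision time $T_0\in(0,\infty)$; put $\bar u(T_0)=0$. The problem is *strongly regularizable via smoothing of the potential* in the ball of radius $\bar R$ if for each $\bar\nu\in S(V)$ the full limit $u_0=\lim_{(\varepsilon,\nu)\to(0^+,\bar\nu)}u_{\varepsilon,\nu}$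 exists ($\varepsilon$ and $\nu$ varying independently), and the extended flow $\tilde u_\nu$, equal to $u_\nu$ for $\nu\notin S(V)$ and to this limit for $\nu\in S(V)$, is continuous with respect to $\nu$. Here paths are considered for $t\ge0$, as long as they stay in the ball, with the topology of uniform convergence on compact time intervals. The regularization is *global* if $\bar R=+\infty$. **Corollary.** For the logarithmic potential $V(x)=-\log x$ one has $\bar R=+\infty$, and the logarithmic one-centre problem is globally strongly regularizable via smoothing of the potential (the extended flow being defined for all data $\nu$ with $q_0\ne0$ and all $t\ge0$). Moreover, collisions are continued by transmission: if $\bar\nu=(\bar q,\bar p)\in S(V)$ has collision solution $\bar u$ with collision time $T_0$, then $$\tilde u_{\bar\nu}(t)=\bar u(t)\ \ (0\le t\le T_0),\qquad \tilde u_{\bar\nu}(t)=-\bar u(2T_0-t)\ \ (T_0\le t\le 2T_0),$$ and after time $2T_0$ the flow resumes from the transmitted state: $\tilde u_{\bar\nu}(2T_0+t)=\tilde u_{(-\bar q,\bar p)}(t)$ for all $t\ge0$, so that every later collision is continued in the same way. -/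

import Mathlib

open Set Filter Topology
open scoped ENNReal

noncomputable section

namespace OneCentre

/-- The Euclidean plane. -/
abbrev Plane : Type := EuclideanSpace ℝ (Fin 2)

/-- The logarithmic potential `V(x) = -log x`, used only at arguments `x > 0`. -/
def logPotential (x : ℝ) : ℝ := -Real.log x

/-- The smoothed potential `V_ε(x) = V(√(x² + ε²))`. -/
def smoothed (V : ℝ → ℝ) (ε : ℝ) (x : ℝ) : ℝ := V (Real.sqrt (x ^ 2 + ε ^ 2))

/-- The central force `∇ (V(|u|))` at the point `u` of the plane. -/
def force (V : ℝ → ℝ) (u : Plane) : Plane := gradient (fun w : Plane => V ‖w‖) u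

/-- `u` solves `ü = ∇ V(|u|)` on the time set `I` (an interval containing `0`, with one-sided
derivatives at end points that belong to it), with `(u(0), u̇(0)) = ν`. -/
def IsSolutionOn (V : ℝ → ℝ) (I : Set ℝ) (ν : Plane × Plane) (u : ℝ → Plane) : Prop :=
  u 0 = ν.1 ∧ ∃ v : ℝ → Plane, v 0 = ν.2 ∧ ∀ t ∈ I,
    HasDerivWithinAt u (v t) I t ∧ HasDerivWithinAt v (force V (u t)) I t

/-- Classical solutions of the singular problem: solutions that do not meet the origin. -/
def IsClassicalSolutionOn (V : ℝ → ℝ) (I : Set ℝ) (ν : Plane × Plane) (u : ℝ → Plane) : Prop :=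
  IsSolutionOn V I ν u ∧ ∀ t ∈ I, u t ≠ 0

/-- `u` is the collision solution with initial datum `ν` and collision instant `T₀`: a classical
solution on `[0, T₀)` inside the closed ball of radius `R` about the origin, which tends to the
origin as `t → T₀⁻` (and is given the value `0` at `T₀`). -/
def IsCollisionSolution (V : ℝ → ℝ) (R : ℝ≥0∞) (ν : Plane × Plane) (T₀ : ℝ) (u : ℝ → Plane) :
    Prop :=
  0 < T₀ ∧ IsClassicalSolutionOn V (Ico 0 T₀) ν u ∧ (∀ t ∈ Ico 0 T₀, ‖u t‖ₑ ≤ R) ∧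
    Tendsto u (𝓝[<] T₀) (𝓝 0) ∧ u T₀ = 0

/-- The set `S(V)` of initial data leading to collision (in the ball of radius `R`). -/
def collisionData (V : ℝ → ℝ) (R : ℝ≥0∞) : Set (Plane × Plane) :=
  {ν | ∃ T₀ u, IsCollisionSolution V R ν T₀ u}

/-- The initial data `(q₀, p₀)` of the singular problem with `q₀ ≠ 0` in the ball of radius `R`. -/
def initialData (R : ℝ≥0∞) : Set (Plane × Plane) := {ν | ν.1 ≠ 0 ∧ ‖ν.1‖ₑ ≤ R}

/-- The path `u` stays in the closed ball of radius `R` during `[0, τ]`. -/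
def StaysInBall (R : ℝ≥0∞) (u : ℝ → Plane) (τ : ℝ) : Prop := ∀ t ∈ Icc 0 τ, ‖u t‖ₑ ≤ R

/-- `Φ ν` is the extended flow `ũ_ν` of a strong regularization via smoothing of the potential in
the ball of radius `R`. Paths are considered for `t ≥ 0` and as long as they stay in the ball, and
paths are compared uniformly on compact time intervals. -/
structure IsStrongRegularization (V : ℝ → ℝ) (R : ℝ≥0∞) (Φ : Plane × Plane → ℝ → Plane) :
    Prop where
  /-- the extended trajectories are continuous paths issuing from the initial position -/
  path : ∀ ν ∈ initialData R, Φ ν 0 = ν.1 ∧ ContinuousOn (Φ ν) (Ici 0)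
  /-- `ũ_ν` is the classical solution `u_ν` of the singular problem if `ν ∉ S(V)` -/
  classical : ∀ ν ∈ initialData R, ν ∉ collisionData V R → ∀ τ, 0 ≤ τ → StaysInBall R (Φ ν) τ →
    IsClassicalSolutionOn V (Icc 0 τ) ν (Φ ν)
  /-- if `μ ∈ S(V)`, then `ũ_μ` is the limit of the solutions `u_{ε,ν}` of the smoothed problems
  as `(ε, ν) → (0⁺, μ)`, where `ε` and `ν` vary independently -/
  limit : ∀ μ ∈ collisionData V R, ∀ τ, 0 ≤ τ → StaysInBall R (Φ μ) τ → ∀ η > 0,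
    ∀ᶠ x : ℝ × (Plane × Plane) in (𝓝[>] (0 : ℝ)) ×ˢ 𝓝 μ,
      (∃ u, IsSolutionOn (smoothed V x.1) (Icc 0 τ) x.2 u) ∧
      ∀ u, IsSolutionOn (smoothed V x.1) (Icc 0 τ) x.2 u →
        ∀ t ∈ Icc 0 τ, dist (u t) (Φ μ t) < η
  /-- the extended flow is continuous with respect to the initial data -/
  continuous : ∀ μ ∈ initialData R, ∀ τ, 0 ≤ τ → StaysInBall R (Φ μ) τ →
    TendstoUniformlyOn Φ (Φ μ) (𝓝[initialData R] μ) (Icc 0 τ)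

/-- `u₀` is, on `[0, 2 T₀]`, the transmission solution of the collision path `u` with collision
instant `T₀`: the motion is reflected through the origin. -/
def IsTransmissionSolution (u : ℝ → Plane) (T₀ : ℝ) (u₀ : ℝ → Plane) : Prop :=
  (∀ t ∈ Icc 0 T₀, u₀ t = u t) ∧ ∀ t ∈ Icc T₀ (2 * T₀), u₀ t = -u (2 * T₀ - t)

/-- The largest `S` such that on `(0, S)` one has `V' < 0`, `V'' > 0`, and `V' / V''` is
decreasing. -/
def monotonicityRadius (V : ℝ → ℝ) : ℝ≥0∞ :=
  sSup {S : ℝ≥0∞ |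
    (∀ x : ℝ, 0 < x → ENNReal.ofReal x < S → deriv V x < 0 ∧ 0 < deriv (deriv V) x) ∧
    StrictAntiOn (fun x => deriv V x / deriv (deriv V) x) {x : ℝ | 0 < x ∧ ENNReal.ofReal x < S}}

/-- The largest `T` such that `V' / V'' ≤ -x / 2` on `(0, T)`. -/
def slopeRadius (V : ℝ → ℝ) : ℝ≥0∞ :=
  sSup {T : ℝ≥0∞ | ∀ x : ℝ, 0 < x → ENNReal.ofReal x < T →
    deriv V x / deriv (deriv V) x ≤ -x / 2}

/-- The radius `R̄ = min {T, S}`, possibly infinite. -/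
def validRadius (V : ℝ → ℝ) : ℝ≥0∞ := min (slopeRadius V) (monotonicityRadius V)

end OneCentre

end

open Set Filter Topology
open scoped ENNReal

noncomputable section

namespace OneCentre

open scoped NNReal RealInnerProductSpace

/-! ### Global solutions of second order equations with bounded Lipschitz right-hand side -/

/-! The singular force is `-u/|u|²` and the smoothed one `-u/(|u|²+ε²)`. Both are instances of `attr
a b`, which is bounded and globally Lipschitz when `b ≥ 0` and `a + b > 0`. Away from the origin the
truncation level `a` can be made harmless, and Grönwall's inequality then gives convergence of the
smoothed flow in phase space, jointly in `ε` and `ν`, along every trajectory that avoids the origin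
(`IsRegularOn.tendstoUniformlyOn_smoothFamily`).

Angular momentum `ℓ` and energy `E` separate the data. Since `ℓ² ≤ |u|²|v|² = |u|²(E - log |u|²)`,
which tends to `0` with `|u|`, a trajectory with `ℓ ≠ 0` stays away from the origin for all time. If
`ℓ = 0` the motion is radial and collides after a finite time `T`. So collision data are exactly
those with `ℓ = 0`.

The heart is the passage through the collision. Just before it the speed is large, and a nearby
smoothed trajectory soon reaches a pericentre, where `u ⊥ v`. Until then the velocity turns by at
most `(π/2)/(|p|²-1)`, with `p` the velocity at the start of this last stretch; the bound is uniform
in `ℓ` and `ε` (`norm_direction_sub_le`). About the pericentre time `s` the smoothed orbit is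
symmetric: `u(s+t) = -Q u(s-t)`, with `Q` the reflection in the line of `v(s)`
(`smoothFlow_reflection`). As `v(s)` is almost parallel to the line of collision, `Q` is almost the
identity on that line, and in the limit `u(T+t) = -u(T-t)`, which is transmission.

At time `2T` the smoothed phase points converge to `(-q, p)`, where `(q, p)` is the initial datum.
Because all limits are joint in `(ε, ν)`, they can be concatenated (`HasSmoothLimit.add`), which
gives the extended flow for all times; the joint limit also gives its continuity in the data. -/

/-- The first order vector field of the equation `ü = g(u)`. -/
def phaseField {E : Type*} (g : E → E) (z : E × E) : E × E := (z.2, g z.1)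

theorem lipschitzWith_phaseField {E : Type*} [NormedAddCommGroup E] {g : E → E} {K : ℝ≥0}
    (hg : LipschitzWith K g) : LipschitzWith (max 1 K) (phaseField g) :=
  LipschitzWith.prod_snd.prodMk (mul_one K ▸ hg.comp LipschitzWith.prod_fst)

section GlobalExistence

variable {E : Type*} [NormedAddCommGroup E] [NormedSpace ℝ E]

theorem phaseField_unique_right {g : E → E} {K : ℝ≥0} (hg : LipschitzWith K g) {τ : ℝ}
    {x y : ℝ → E × E}
    (hx : ∀ t ∈ Icc 0 τ, HasDerivWithinAt x (phaseField g (x t)) (Icc 0 τ) t)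
    (hy : ∀ t ∈ Icc 0 τ, HasDerivWithinAt y (phaseField g (y t)) (Icc 0 τ) t)
    (h0 : x 0 = y 0) : EqOn x y (Icc 0 τ) :=
  ODE_solution_unique (v := fun _ => phaseField g) (fun _ => lipschitzWith_phaseField hg)
    (fun t ht => (hx t ht).continuousWithinAt)
    (fun t ht => (hx t (Ico_subset_Icc_self ht)).mono_of_mem_nhdsWithin (Icc_mem_nhdsGE_of_mem ht))
    (fun t ht => (hy t ht).continuousWithinAt)
    (fun t ht => (hy t (Ico_subset_Icc_self ht)).mono_of_mem_nhdsWithin (Icc_mem_nhdsGE_of_mem ht))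
    h0

variable [CompleteSpace E]

/-- The phase field is unbounded in the velocity, so plain Picard–Lindelöf only gives short times.
Rescaling the velocity by `c = 2τ` cures this: on the ball of radius `a` the position component is
at most `(a + c‖ν.2‖)/c ≤ 2a/c = a/τ`, so no solution leaves the ball within time `τ`. The two terms
of `a` ensure `c‖ν.2‖ ≤ a` and `cMτ ≤ a`. -/
theorem exists_phaseField_solution_Icc {g : E → E} {K : ℝ≥0} (hg : LipschitzWith K g) {M : ℝ≥0}
    (hM : ∀ u, ‖g u‖ ≤ M) (ν : E × E) {τ : ℝ} (hτ : 0 < τ) :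
    ∃ z : ℝ → E × E, z 0 = ν ∧
      ∀ t ∈ Icc (-τ) τ, HasDerivWithinAt z (phaseField g (z t)) (Icc (-τ) τ) t := by
  lift τ to ℝ≥0 using hτ.le
  have hτ' : (τ : ℝ) ≠ 0 := hτ.ne'
  set c : ℝ := 2 * τ with hc
  have hc0 : 0 < c := by positivity
  let f : E × E → E × E := fun z => (c⁻¹ • z.2, c • g z.1)
  have hf : LipschitzWith (max ‖c⁻¹‖₊ (‖c‖₊ * K)) f := by
    refine LipschitzWith.prodMk ?_ ?_
    · exact mul_one ‖c⁻¹‖₊ ▸ (lipschitzWith_smul c⁻¹).comp LipschitzWith.prod_snd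
    · exact mul_one (‖c‖₊ * K) ▸ ((lipschitzWith_smul c).comp hg).comp LipschitzWith.prod_fst
  let a : ℝ≥0 := 2 * τ * ‖ν.2‖₊ + 2 * τ ^ 2 * M
  have ha : (a : ℝ) = 2 * τ * ‖ν.2‖ + 2 * τ ^ 2 * M := by simp [a]
  have h0 : (0 : ℝ) ∈ Icc (-(τ : ℝ)) τ := ⟨by linarith, hτ.le⟩
  have hPL : IsPicardLindelof (fun _ => f) (tmin := -τ) (tmax := τ) ⟨0, h0⟩ (ν.1, c • ν.2)
      a 0 (a / τ) (max ‖c⁻¹‖₊ (‖c‖₊ * K)) := by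
    refine IsPicardLindelof.of_time_independent ?_ hf.lipschitzOnWith ?_
    · intro z hz
      have hz2 : ‖z.2‖ ≤ a + c * ‖ν.2‖ := by
        have h1 : ‖z.2 - c • ν.2‖ ≤ a := by
          have h2 := mem_closedBall_iff_norm.1 hz
          exact (norm_snd_le (z - (ν.1, c • ν.2))).trans h2
        have h3 := norm_le_norm_add_norm_sub' z.2 (c • ν.2)
        rw [norm_smul, Real.norm_of_nonneg hc0.le] at h3
        linarith
      have hac : c * ‖ν.2‖ ≤ a := by
        rw [ha, hc]
        have : (0 : ℝ) ≤ 2 * τ ^ 2 * M := by positivity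
        linarith
      have hgc : c * M * τ ≤ a := by
        rw [ha, hc]
        have : (0 : ℝ) ≤ 2 * τ * ‖ν.2‖ := by positivity
        nlinarith
      rw [NNReal.coe_div, Prod.norm_def]
      refine max_le ?_ ?_
      · simp only [f, norm_smul, norm_inv, Real.norm_of_nonneg hc0.le]
        rw [le_div_iff₀ hτ, inv_mul_eq_div, div_mul_eq_mul_div, div_le_iff₀ hc0, hc]
        nlinarith
      · simp only [f, norm_smul, Real.norm_of_nonneg hc0.le]
        rw [le_div_iff₀ hτ]
        refine le_trans ?_ hgc
        have := hM z.1
        gcongr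
    · simp
      rw [div_mul_cancel₀ _ hτ']
  obtain ⟨α, hα0, hα⟩ := hPL.exists_eq_forall_mem_Icc_hasDerivWithinAt₀
  refine ⟨fun t => ((α t).1, c⁻¹ • (α t).2), ?_, fun t ht => ?_⟩
  · have : α 0 = (ν.1, c • ν.2) := hα0
    simp [this, hc0.ne']
  · have h := hα t ht
    have h1 := (ContinuousLinearMap.fst ℝ E E).hasFDerivAt.comp_hasDerivWithinAt t h
    have h2 := ((ContinuousLinearMap.snd ℝ E E).hasFDerivAt.comp_hasDerivWithinAt t h).const_smul
      c⁻¹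
    have h3 := h1.prodMk h2
    refine h3.congr_deriv ?_
    simp [f, phaseField, hc0.ne']

theorem exists_phaseField_solution {g : E → E} {K : ℝ≥0} (hg : LipschitzWith K g) {M : ℝ≥0}
    (hM : ∀ u, ‖g u‖ ≤ M) (ν : E × E) :
    ∃ z : ℝ → E × E, z 0 = ν ∧ ∀ t, HasDerivAt z (phaseField g (z t)) t := by
  have hex : ∀ n : ℝ, ∃ z : ℝ → E × E, z 0 = ν ∧ (0 < n →
      ∀ t ∈ Icc (-n) n, HasDerivWithinAt z (phaseField g (z t)) (Icc (-n) n) t) := by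
    intro n
    by_cases hn : 0 < n
    · obtain ⟨z, h0, h⟩ := exists_phaseField_solution_Icc hg hM ν hn
      exact ⟨z, h0, fun _ => h⟩
    · exact ⟨fun _ => ν, rfl, fun h => absurd h hn⟩
  choose z hz0 hz using hex
  have hzd : ∀ n, 0 < n → ∀ t ∈ Ioo (-n) n, HasDerivAt (z n) (phaseField g (z n t)) t :=
    fun n hn t ht => (hz n hn t (Ioo_subset_Icc_self ht)).hasDerivAt (Icc_mem_nhds ht.1 ht.2)
  have huniq : ∀ m n, 0 < m → m ≤ n → EqOn (z m) (z n) (Ioo (-m) m) := by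
    intro m n hm hmn
    refine ODE_solution_unique_of_mem_Ioo (v := fun _ => phaseField g) (s := fun _ => univ)
      (K := max 1 K) (t₀ := 0) (fun _ _ => (lipschitzWith_phaseField hg).lipschitzOnWith)
      ⟨by linarith, hm⟩ (fun t ht => ⟨hzd m hm t ht, trivial⟩)
      (fun t ht => ⟨hzd n (hm.trans_le hmn) t ⟨by linarith [ht.1], by linarith [ht.2]⟩, trivial⟩) ?_
    rw [hz0, hz0]
  have habs : ∀ t : ℝ, t ∈ Ioo (-(|t| + 1)) (|t| + 1) := fun t =>
    abs_lt.1 (by linarith)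
  -- Gluing of the solutions on `[-n, n]`; the radius `|t| + 1` keeps `t` in the interior.
  refine ⟨fun t => z (|t| + 1) t, hz0 _, fun t => ?_⟩
  have hpos : (0 : ℝ) < |t| + 1 := by positivity
  have h := hzd _ hpos t (habs t)
  refine h.congr_of_eventuallyEq ?_
  filter_upwards [Ioo_mem_nhds (habs t).1 (habs t).2] with s hs
  rcases le_total |s| |t| with hst | hst
  · exact huniq _ _ (by positivity) (by linarith) (habs s)
  · exact (huniq _ _ hpos (by linarith) hs).symm

end GlobalExistence

/-! ### The attractive fields -/

/-- The central field `-u / (max |u|² a + b)`. -/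
def attr (a b : ℝ) (u : Plane) : Plane := -((max (‖u‖ ^ 2) a + b)⁻¹ • u)

/-- Split the difference as `A⁻¹(u - w) + ((B - A)/(AB)) w`. The first term costs `1/c`; the second
costs `2/c`, because `|B - A| ≤ ‖u - w‖(‖u‖ + ‖w‖)` and `(‖u‖ + ‖w‖)‖w‖c ≤ 2AB`. -/
theorem norm_inv_smul_sub_inv_smul_le {E : Type*} [SeminormedAddCommGroup E] [NormedSpace ℝ E]
    {u w : E} {A B c : ℝ} (hc : 0 < c) (hA : c ≤ A) (hB : c ≤ B)
    (hu : ‖u‖ ^ 2 ≤ A) (hw : ‖w‖ ^ 2 ≤ B) (hAB : |B - A| ≤ |‖w‖ ^ 2 - ‖u‖ ^ 2|) :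
    ‖A⁻¹ • u - B⁻¹ • w‖ ≤ 3 / c * ‖u - w‖ := by
  have hA0 : 0 < A := hc.trans_le hA
  have hB0 : 0 < B := hc.trans_le hB
  have e : A⁻¹ • u - B⁻¹ • w = A⁻¹ • (u - w) + ((B - A) / (A * B)) • w := by
    have : (B - A) / (A * B) = A⁻¹ - B⁻¹ := by field_simp
    rw [this]; module
  have h1 : ‖A⁻¹ • (u - w)‖ ≤ 1 / c * ‖u - w‖ := by
    rw [norm_smul, norm_inv, Real.norm_of_nonneg hA0.le, one_div]
    gcongr
  have h2 : ‖((B - A) / (A * B)) • w‖ ≤ 2 / c * ‖u - w‖ := by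
    rw [norm_smul, norm_div, Real.norm_eq_abs, Real.norm_of_nonneg (by positivity : 0 ≤ A * B)]
    have h3 : |‖w‖ ^ 2 - ‖u‖ ^ 2| ≤ ‖u - w‖ * (‖u‖ + ‖w‖) := by
      rw [sq_sub_sq, abs_mul, abs_of_nonneg (by positivity : 0 ≤ ‖w‖ + ‖u‖), mul_comm,
        add_comm ‖w‖, norm_sub_rev]
      gcongr
      exact abs_norm_sub_norm_le _ _
    have h4 : (‖u‖ + ‖w‖) * ‖w‖ * c ≤ 2 * (A * B) := by
      have h5 : ‖w‖ ^ 2 * c ≤ B * A := by gcongr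
      have h6 : (2 * (‖u‖ * ‖w‖)) * c ≤ (A + B) * c := by
        gcongr
        nlinarith [sq_nonneg (‖u‖ - ‖w‖)]
      nlinarith
    have h7 : |B - A| * ‖w‖ ≤ ‖u - w‖ * ((‖u‖ + ‖w‖) * ‖w‖) := by
      rw [← mul_assoc]
      gcongr
      exact hAB.trans h3
    rw [div_mul_eq_mul_div, div_le_iff₀ (by positivity), div_mul_eq_mul_div, div_mul_eq_mul_div,
      le_div_iff₀ hc]
    calc |B - A| * ‖w‖ * c ≤ ‖u - w‖ * ((‖u‖ + ‖w‖) * ‖w‖) * c := by gcongr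
      _ = ‖u - w‖ * ((‖u‖ + ‖w‖) * ‖w‖ * c) := by ring
      _ ≤ ‖u - w‖ * (2 * (A * B)) := by gcongr
      _ = _ := by ring
  rw [e]
  refine (norm_add_le _ _).trans ?_
  have : 3 / c * ‖u - w‖ = 1 / c * ‖u - w‖ + 2 / c * ‖u - w‖ := by ring
  linarith

theorem lipschitzWith_attr {a b : ℝ} (hb : 0 ≤ b) (hab : 0 < a + b) :
    LipschitzWith (3 / (a + b)).toNNReal (attr a b) := by
  refine LipschitzWith.of_dist_le_mul fun u w => ?_
  rw [Real.coe_toNNReal _ (div_nonneg zero_le_three hab.le), dist_eq_norm, dist_eq_norm, attr, attr, neg_sub_neg,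
    norm_sub_rev]
  have hc : ∀ x : Plane, a + b ≤ max (‖x‖ ^ 2) a + b := fun x => by
    linarith [le_max_right (‖x‖ ^ 2) a]
  have hn : ∀ x : Plane, ‖x‖ ^ 2 ≤ max (‖x‖ ^ 2) a + b := fun x => by
    linarith [le_max_left (‖x‖ ^ 2) a]
  refine norm_inv_smul_sub_inv_smul_le hab (hc u) (hc w) (hn u) (hn w) ?_
  rw [add_sub_add_right_eq_sub]
  exact abs_max_sub_max_le_abs _ _ _

theorem norm_le_max_mul {a b : ℝ} (hb : 0 ≤ b) (hab : 0 < a + b) (u : Plane) :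
    ‖u‖ ≤ (max (‖u‖ ^ 2) a + b) * (1 + 1 / (a + b)) := by
  have h1 : a + b ≤ max (‖u‖ ^ 2) a + b := by linarith [le_max_right (‖u‖ ^ 2) a]
  have h2 : ‖u‖ ^ 2 ≤ max (‖u‖ ^ 2) a + b := by linarith [le_max_left (‖u‖ ^ 2) a]
  have h3 : 1 ≤ (max (‖u‖ ^ 2) a + b) * (1 / (a + b)) := by
    rw [mul_one_div, one_le_div hab]; exact h1
  nlinarith [sq_nonneg (‖u‖ - 1), norm_nonneg u]

theorem norm_attr_le {a b : ℝ} (hb : 0 ≤ b) (hab : 0 < a + b) (u : Plane) :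
    ‖attr a b u‖ ≤ 1 + 1 / (a + b) := by
  have h1 : 0 < max (‖u‖ ^ 2) a + b := by linarith [le_max_right (‖u‖ ^ 2) a]
  rw [attr, norm_neg, norm_smul, norm_inv, Real.norm_of_nonneg h1.le, inv_mul_le_iff₀ h1]
  exact norm_le_max_mul hb hab u

/-- With `b = ε²` this is the error term for Grönwall: at a fixed truncation level, smoothing
changes the field by `O(ε²)` uniformly in the plane. -/
theorem norm_attr_sub_attr_zero_le {a b : ℝ} (ha : 0 < a) (hb : 0 ≤ b) (u : Plane) :
    ‖attr a b u - attr a 0 u‖ ≤ b * (1 + 1 / a) / a := by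
  set A := max (‖u‖ ^ 2) a with hA
  have hAa : a ≤ A := le_max_right _ _
  have hA0 : 0 < A := ha.trans_le hAa
  have e : attr a b u - attr a 0 u = (b / (A * (A + b))) • u := by
    have : b / (A * (A + b)) = A⁻¹ - (A + b)⁻¹ := by field_simp; ring
    rw [attr, attr, this, ← hA, add_zero]; module
  have hn : ‖u‖ ≤ A * (1 + 1 / a) := by
    simpa using norm_le_max_mul (a := a) (b := 0) le_rfl (by simpa using ha) u
  rw [e, norm_smul, Real.norm_of_nonneg (by positivity)]
  calc b / (A * (A + b)) * ‖u‖ ≤ b / (A * (A + b)) * (A * (1 + 1 / a)) := by gcongr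
    _ = b * (1 + 1 / a) / (A + b) := by field_simp
    _ ≤ b * (1 + 1 / a) / a := by gcongr; linarith

theorem attr_eq_of_le {a b : ℝ} {u : Plane} (h : a ≤ ‖u‖ ^ 2) :
    attr a b u = -((‖u‖ ^ 2 + b)⁻¹ • u) := by
  rw [attr, max_eq_left h]

theorem attr_zero_left (b : ℝ) (u : Plane) : attr 0 b u = -((‖u‖ ^ 2 + b)⁻¹ • u) :=
  attr_eq_of_le (sq_nonneg _)

theorem attr_neg (a b : ℝ) (u : Plane) : attr a b (-u) = -attr a b u := by
  simp [attr]

theorem attr_map (a b : ℝ) (f : Plane ≃ₗᵢ[ℝ] Plane) (u : Plane) :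
    attr a b (f u) = f (attr a b u) := by
  simp [attr]

/-! ### The forces -/

theorem hasGradientAt_neg_half_log {b : ℝ} {u : Plane} (h : 0 < ‖u‖ ^ 2 + b) :
    HasGradientAt (fun w : Plane => -(1 / 2 * Real.log (‖w‖ ^ 2 + b))) (attr 0 b u) u := by
  rw [hasGradientAt_iff_hasFDerivAt]
  have h1 := ((((hasStrictFDerivAt_norm_sq u).hasFDerivAt.add_const b).log h.ne').const_mul
    (1 / 2)).neg
  refine h1.congr_fderiv ?_
  ext w
  simp [attr_zero_left]
  ring

theorem force_smoothed_logPotential {ε : ℝ} (hε : ε ≠ 0) (u : Plane) :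
    force (smoothed logPotential ε) u = attr 0 (ε ^ 2) u := by
  have h : (fun w : Plane => smoothed logPotential ε ‖w‖)
      = fun w : Plane => -(1 / 2 * Real.log (‖w‖ ^ 2 + ε ^ 2)) := by
    funext w
    rw [smoothed, logPotential, Real.log_sqrt (by positivity)]
    ring
  rw [force, h]
  exact (hasGradientAt_neg_half_log (by positivity)).gradient

theorem force_logPotential {u : Plane} (hu : u ≠ 0) : force logPotential u = attr 0 0 u := by
  have h : (fun w : Plane => logPotential ‖w‖)
      = fun w : Plane => -(1 / 2 * Real.log (‖w‖ ^ 2 + 0)) := by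
    funext w
    rw [logPotential, add_zero, Real.log_pow]
    push_cast; ring
  rw [force, h]
  exact (hasGradientAt_neg_half_log (by simpa using pow_pos (norm_pos_iff.2 hu) 2)).gradient

theorem IsSolutionOn.exists_phase {V : ℝ → ℝ} {I : Set ℝ} {ν : Plane × Plane} {u : ℝ → Plane}
    (h : IsSolutionOn V I ν u) : ∃ z : ℝ → Plane × Plane, z 0 = ν ∧ (∀ t, (z t).1 = u t) ∧
      ∀ t ∈ I, HasDerivWithinAt z (phaseField (force V) (z t)) I t := by
  obtain ⟨h0, v, hv0, h⟩ := h
  exact ⟨fun t => (u t, v t), Prod.ext h0 hv0, fun _ => rfl,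
    fun t ht => (h t ht).1.prodMk (h t ht).2⟩

theorem hasDerivWithinAt_phase_fst {g : Plane → Plane} {z : ℝ → Plane × Plane} {I : Set ℝ} {t : ℝ}
    (h : HasDerivWithinAt z (phaseField g (z t)) I t) :
    HasDerivWithinAt (fun s => (z s).1) (z t).2 I t :=
  (ContinuousLinearMap.fst ℝ Plane Plane).hasFDerivAt.comp_hasDerivWithinAt t h

theorem hasDerivWithinAt_phase_snd {g : Plane → Plane} {z : ℝ → Plane × Plane} {I : Set ℝ} {t : ℝ}
    (h : HasDerivWithinAt z (phaseField g (z t)) I t) :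
    HasDerivWithinAt (fun s => (z s).2) (g (z t).1) I t :=
  (ContinuousLinearMap.snd ℝ Plane Plane).hasFDerivAt.comp_hasDerivWithinAt t h

theorem isSolutionOn_of_phase {V : ℝ → ℝ} {g : Plane → Plane} {I : Set ℝ} {z : ℝ → Plane × Plane}
    (h : ∀ t ∈ I, HasDerivWithinAt z (phaseField g (z t)) I t)
    (hg : ∀ t ∈ I, force V (z t).1 = g (z t).1) : IsSolutionOn V I (z 0) fun t => (z t).1 :=
  ⟨rfl, fun t => (z t).2, rfl, fun t ht => ⟨hasDerivWithinAt_phase_fst (h t ht), by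
    rw [hg t ht]; exact hasDerivWithinAt_phase_snd (h t ht)⟩⟩

/-! ### The flow of the smoothed problem -/

theorem exists_attr_solution {a b : ℝ} (hb : 0 ≤ b) (hab : 0 < a + b)
    (ν : Plane × Plane) :
    ∃ z : ℝ → Plane × Plane, z 0 = ν ∧ ∀ t, HasDerivAt z (phaseField (attr a b) (z t)) t :=
  exists_phaseField_solution (lipschitzWith_attr hb hab)
    (M := ⟨1 + 1 / (a + b), by linarith [one_div_nonneg.2 hab.le]⟩)
    (norm_attr_le hb hab) ν

theorem exists_smoothFlow (ε : ℝ) (ν : Plane × Plane) :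
    ∃ z : ℝ → Plane × Plane, z 0 = ν ∧
      (0 < ε → ∀ t, HasDerivAt z (phaseField (attr 0 (ε ^ 2)) (z t)) t) := by
  by_cases hε : 0 < ε
  · obtain ⟨z, h0, h⟩ := exists_attr_solution (a := 0) (sq_nonneg ε) (by positivity) ν
    exact ⟨z, h0, fun _ => h⟩
  -- Default value for `ε ≤ 0`, which makes the flow total in `ε`.
  · exact ⟨fun _ => ν, rfl, fun h => absurd h hε⟩

/-- The phase flow of the smoothed logarithmic problem, for `ε > 0`. -/
def smoothFlow (ε : ℝ) (ν : Plane × Plane) : ℝ → Plane × Plane := (exists_smoothFlow ε ν).choose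

@[simp]
theorem smoothFlow_zero (ε : ℝ) (ν : Plane × Plane) : smoothFlow ε ν 0 = ν :=
  (exists_smoothFlow ε ν).choose_spec.1

theorem hasDerivAt_smoothFlow {ε : ℝ} (hε : 0 < ε) (ν : Plane × Plane) (t : ℝ) :
    HasDerivAt (smoothFlow ε ν) (phaseField (attr 0 (ε ^ 2)) (smoothFlow ε ν t)) t :=
  (exists_smoothFlow ε ν).choose_spec.2 hε t

theorem continuous_smoothFlow {ε : ℝ} (hε : 0 < ε) (ν : Plane × Plane) : Continuous (smoothFlow ε ν) :=
  continuous_iff_continuousAt.2 fun t => (hasDerivAt_smoothFlow hε ν t).continuousAt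

theorem lipschitzWith_attr_sq {ε : ℝ} (hε : 0 < ε) : LipschitzWith (3 / (0 + ε ^ 2)).toNNReal (attr 0 (ε ^ 2)) :=
  lipschitzWith_attr (sq_nonneg ε) (by positivity)

theorem eq_smoothFlow {ε : ℝ} (hε : 0 < ε) {z : ℝ → Plane × Plane}
    (hz : ∀ t, HasDerivAt z (phaseField (attr 0 (ε ^ 2)) (z t)) t) : z = smoothFlow ε (z 0) :=
  ODE_solution_unique_univ (v := fun _ => phaseField (attr 0 (ε ^ 2))) (s := fun _ => univ)
    (t₀ := 0) (fun _ => (lipschitzWith_phaseField (lipschitzWith_attr_sq hε)).lipschitzOnWith)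
    (fun t => ⟨hz t, trivial⟩) (fun t => ⟨hasDerivAt_smoothFlow hε _ t, trivial⟩) (by simp)

theorem eqOn_smoothFlow {ε : ℝ} (hε : 0 < ε) {z : ℝ → Plane × Plane} {τ : ℝ}
    (hz : ∀ t ∈ Icc 0 τ, HasDerivWithinAt z (phaseField (attr 0 (ε ^ 2)) (z t)) (Icc 0 τ) t) :
    EqOn z (smoothFlow ε (z 0)) (Icc 0 τ) :=
  phaseField_unique_right (lipschitzWith_attr_sq hε) hz
    (fun t _ => (hasDerivAt_smoothFlow hε _ t).hasDerivWithinAt) (by simp)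

theorem smoothFlow_add {ε : ℝ} (hε : 0 < ε) (ν : Plane × Plane) (s t : ℝ) :
    smoothFlow ε ν (s + t) = smoothFlow ε (smoothFlow ε ν s) t := by
  have h := eq_smoothFlow hε (z := fun t => smoothFlow ε ν (s + t))
    (fun t => (hasDerivAt_smoothFlow hε ν (s + t)).comp_const_add s t)
  have := congrFun h t
  simpa using this

theorem isSolutionOn_smoothFlow {ε : ℝ} (hε : 0 < ε) (ν : Plane × Plane) (I : Set ℝ) :
    IsSolutionOn (smoothed logPotential ε) I ν fun t => (smoothFlow ε ν t).1 := by
  have h := isSolutionOn_of_phase (V := smoothed logPotential ε) (I := I)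
    (fun t _ => (hasDerivAt_smoothFlow hε ν t).hasDerivWithinAt)
    (fun t _ => force_smoothed_logPotential hε.ne' _)
  rwa [smoothFlow_zero] at h

theorem IsSolutionOn.eqOn_smoothFlow {ε : ℝ} (hε : 0 < ε) {ν : Plane × Plane} {τ : ℝ} {u : ℝ → Plane}
    (h : IsSolutionOn (smoothed logPotential ε) (Icc 0 τ) ν u) :
    EqOn u (fun t => (smoothFlow ε ν t).1) (Icc 0 τ) := by
  obtain ⟨z, h0, hzu, hz⟩ := h.exists_phase
  rw [funext (force_smoothed_logPotential hε.ne')] at hz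
  intro t ht
  rw [← h0, ← hzu]
  exact congrArg Prod.fst (OneCentre.eqOn_smoothFlow hε hz ht)

/-! ### The radius of validity -/

theorem deriv_logPotential (x : ℝ) : deriv logPotential x = -x⁻¹ := by
  have : logPotential = -Real.log := rfl
  rw [this, deriv.neg, Real.deriv_log]

theorem deriv_deriv_logPotential (x : ℝ) : deriv (deriv logPotential) x = (x ^ 2)⁻¹ := by
  rw [funext deriv_logPotential]
  simp

theorem deriv_logPotential_div {x : ℝ} (hx : 0 < x) :
    deriv logPotential x / deriv (deriv logPotential) x = -x := by
  rw [deriv_logPotential, deriv_deriv_logPotential]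
  field_simp

/-- Here `V'/V'' = -x` on the whole half-line, so `⊤` itself belongs to both sets of admissible
radii. -/
theorem validRadius_logPotential : validRadius logPotential = ⊤ := by
  rw [validRadius, slopeRadius, monotonicityRadius, min_eq_top]
  constructor
  · refine top_le_iff.1 (le_sSup fun x hx _ => ?_)
    rw [deriv_logPotential_div hx]
    linarith
  · refine top_le_iff.1 (le_sSup ⟨fun x hx _ => ?_, fun x hx y hy hxy => ?_⟩)
    · rw [deriv_logPotential, deriv_deriv_logPotential]
      exact ⟨by simpa using hx, by positivity⟩
    · simp only [deriv_logPotential_div hx.1, deriv_logPotential_div hy.1]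
      linarith

/-! ### Convergence of the smoothed flow along regular trajectories -/

/-- `z` is a trajectory of the singular problem in the phase space on `[0, τ]`, which does not meet
the singularity. -/
def IsRegularOn (τ : ℝ) (z : ℝ → Plane × Plane) : Prop :=
  ∀ t ∈ Icc 0 τ, (z t).1 ≠ 0 ∧ HasDerivWithinAt z (phaseField (attr 0 0) (z t)) (Icc 0 τ) t

theorem IsRegularOn.continuousOn {τ : ℝ} {z : ℝ → Plane × Plane} (h : IsRegularOn τ z) :
    ContinuousOn z (Icc 0 τ) := fun t ht => (h t ht).2.continuousWithinAt

theorem IsRegularOn.mono {τ σ : ℝ} {z : ℝ → Plane × Plane} (h : IsRegularOn τ z) (hσ : σ ≤ τ) :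
    IsRegularOn σ z := fun t ht =>
  ⟨(h t ⟨ht.1, ht.2.trans hσ⟩).1, (h t ⟨ht.1, ht.2.trans hσ⟩).2.mono (Icc_subset_Icc_right hσ)⟩

theorem IsRegularOn.exists_lower_bound {τ : ℝ} {z : ℝ → Plane × Plane} (h : IsRegularOn τ z)
    (hτ : 0 ≤ τ) : ∃ r > 0, ∀ t ∈ Icc 0 τ, r ≤ ‖(z t).1‖ := by
  obtain ⟨s, hs, hmin⟩ := isCompact_Icc.exists_isMinOn (nonempty_Icc.2 hτ)
    (continuous_fst.comp_continuousOn h.continuousOn).norm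
  exact ⟨_, norm_pos_iff.2 (h s hs).1, fun t ht => hmin ht⟩

theorem IsRegularOn.isClassicalSolutionOn {τ : ℝ} {z : ℝ → Plane × Plane} (h : IsRegularOn τ z) :
    IsClassicalSolutionOn logPotential (Icc 0 τ) (z 0) fun t => (z t).1 :=
  ⟨isSolutionOn_of_phase (fun t ht => (h t ht).2) fun t ht => force_logPotential (h t ht).1,
    fun t ht => (h t ht).1⟩

/-- The filter describing the independent limits `ε → 0⁺` and `ν → μ`. -/
def smoothingFilter (μ : Plane × Plane) : Filter (ℝ × (Plane × Plane)) := 𝓝[>] (0 : ℝ) ×ˢ 𝓝 μ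

instance (μ : Plane × Plane) : (smoothingFilter μ).NeBot := by
  unfold smoothingFilter; infer_instance

theorem eventually_smoothing_pos (μ : Plane × Plane) : ∀ᶠ x in smoothingFilter μ, 0 < x.1 :=
  tendsto_fst.eventually (self_mem_nhdsWithin (a := (0 : ℝ)) (s := Ioi 0))

theorem smoothingFilter_le_nhds (μ : Plane × Plane) : smoothingFilter μ ≤ 𝓝 (0, μ) := by
  rw [nhds_prod_eq]
  exact Filter.prod_mono nhdsWithin_le_nhds le_rfl

/-- The smoothed flow, as a family indexed by the smoothing parameter and the initial datum. -/
def smoothFamily (x : ℝ × (Plane × Plane)) : ℝ → Plane × Plane := smoothFlow x.1 x.2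

theorem dist_le_gronwallBound_attr {a b τ : ℝ} (ha : 0 < a) (hb : 0 ≤ b)
    {y z : ℝ → Plane × Plane}
    (hy : ∀ t, HasDerivAt y (phaseField (attr a b) (y t)) t)
    (hz : ∀ t ∈ Icc 0 τ, HasDerivWithinAt z (phaseField (attr a 0) (z t)) (Icc 0 τ) t) :
    ∀ t ∈ Icc 0 τ, dist (y t) (z t) ≤ gronwallBound (dist (y 0) (z 0))
      (max 1 (3 / (a + 0)).toNNReal : ℝ≥0) (b * (1 + 1 / a) / a) τ := by
  intro t ht
  have h := dist_le_of_approx_trajectories_ODE (v := fun _ => phaseField (attr a 0))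
    (K := max 1 (3 / (a + 0)).toNNReal) (f := y) (g := z) (a := 0) (b := τ)
    (εf := b * (1 + 1 / a) / a) (εg := 0) (δ := dist (y 0) (z 0))
    (fun _ => lipschitzWith_phaseField (lipschitzWith_attr le_rfl (by simpa using ha)))
    (fun s _ => (hy s).continuousAt.continuousWithinAt) (fun s _ => (hy s).hasDerivWithinAt)
    (fun s _ => ?_) (fun s hs => (hz s hs).continuousWithinAt)
    (fun s hs => (hz s (Ico_subset_Icc_self hs)).mono_of_mem_nhdsWithin
      (Icc_mem_nhdsGE_of_mem hs))
    (fun s _ => (dist_self _).le) le_rfl t ht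
  · rw [add_zero (b * (1 + 1 / a) / a), sub_zero] at h
    exact h.trans (gronwallBound_mono dist_nonneg (by positivity) (by positivity) ht.2)
  · rw [phaseField, phaseField, dist_eq_norm, Prod.mk_sub_mk, sub_self, Prod.norm_mk, norm_zero]
    exact max_le (by positivity) (norm_attr_sub_attr_zero_le ha hb _)

/-- Truncate at half the minimal distance `r` of `z` from the origin. Grönwall brings the truncated
smoothed solution within `r/2` of `z`; there the truncation is inactive, so by uniqueness it is the
true smoothed flow. -/
theorem IsRegularOn.tendstoUniformlyOn_smoothFamily {τ : ℝ} (hτ : 0 ≤ τ) {z : ℝ → Plane × Plane}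
    (h : IsRegularOn τ z) :
    TendstoUniformlyOn smoothFamily z (smoothingFilter (z 0)) (Icc 0 τ) := by
  obtain ⟨r, hr, hzr⟩ := h.exists_lower_bound hτ
  set a : ℝ := (r / 2) ^ 2 with ha_def
  have ha : 0 < a := by positivity
  have hz : ∀ t ∈ Icc 0 τ, HasDerivWithinAt z (phaseField (attr a 0) (z t)) (Icc 0 τ) t := by
    intro t ht
    have e : attr a 0 (z t).1 = attr 0 0 (z t).1 := by
      rw [attr_zero_left, attr_eq_of_le]
      have := hzr t ht
      rw [ha_def]; gcongr; linarith
    have := (h t ht).2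
    rwa [phaseField, ← e] at this
  set K : ℝ≥0 := max 1 (3 / (a + 0)).toNNReal with hK
  have hK1 : (K : ℝ) ≠ 0 := by
    have : (1 : ℝ≥0) ≤ K := le_max_left _ _
    exact_mod_cast (zero_lt_one.trans_le this).ne'
  have hlim : Tendsto (fun x : ℝ × (Plane × Plane) =>
      gronwallBound (dist x.2 (z 0)) K (x.1 ^ 2 * (1 + 1 / a) / a) τ)
      (smoothingFilter (z 0)) (𝓝 0) := by
    have hc : Continuous fun x : ℝ × (Plane × Plane) =>
        gronwallBound (dist x.2 (z 0)) K (x.1 ^ 2 * (1 + 1 / a) / a) τ := by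
      simp only [gronwallBound_of_K_ne_0 hK1]
      fun_prop
    have := hc.tendsto (0, z 0)
    have e : gronwallBound (dist (z 0) (z 0)) K ((0 : ℝ) ^ 2 * (1 + 1 / a) / a) τ = 0 := by
      simp [gronwallBound_ε0_δ0]
    simp only [e] at this
    exact this.mono_left (smoothingFilter_le_nhds _)
  rw [Metric.tendstoUniformlyOn_iff]
  intro η hη
  filter_upwards [hlim.eventually (gt_mem_nhds (lt_min hη (half_pos hr))),
    eventually_smoothing_pos _] with x hx hε t ht
  obtain ⟨y, hy0, hy⟩ := exists_attr_solution (a := a) (sq_nonneg x.1) (by positivity) x.2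
  have hyz : ∀ t ∈ Icc 0 τ, dist (y t) (z t) < min η (r / 2) := fun t ht => by
    have := dist_le_gronwallBound_attr ha (sq_nonneg x.1) hy hz t ht
    rw [hy0] at this
    exact this.trans_lt hx
  have hyX : EqOn y (smoothFlow x.1 (y 0)) (Icc 0 τ) := by
    refine eqOn_smoothFlow hε fun s hs => ?_
    have e : attr a (x.1 ^ 2) (y s).1 = attr 0 (x.1 ^ 2) (y s).1 := by
      rw [attr_zero_left, attr_eq_of_le]
      have h1 : dist (y s).1 (z s).1 ≤ dist (y s) (z s) := le_max_left _ _
      have h2 := (hyz s hs).trans_le (min_le_right _ _)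
      have h3 := hzr s hs
      have h4 := norm_le_norm_add_norm_sub (y s).1 (z s).1
      rw [dist_eq_norm] at h1
      rw [ha_def]; gcongr; linarith
    have := (hy s).hasDerivWithinAt (s := Icc 0 τ)
    rwa [phaseField, e] at this
  rw [smoothFamily, ← hy0, ← hyX ht, dist_comm]
  exact (hyz t ht).trans_le (min_le_left _ _)

/-! ### Conserved quantities -/

/-- The angular momentum of a state. -/
def angMom (z : Plane × Plane) : ℝ := z.1 0 * z.2 1 - z.1 1 * z.2 0

/-- Lagrange's identity. It bounds `ℓ` near the origin and later controls how fast the velocity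
turns. -/
theorem angMom_sq_add_inner_sq (z : Plane × Plane) :
    angMom z ^ 2 + ⟪z.1, z.2⟫ ^ 2 = ‖z.1‖ ^ 2 * ‖z.2‖ ^ 2 := by
  simp only [EuclideanSpace.real_norm_sq_eq, PiLp.inner_apply, Fin.sum_univ_two, angMom]
  simp
  ring

theorem angMom_sq_le (z : Plane × Plane) : angMom z ^ 2 ≤ ‖z.1‖ ^ 2 * ‖z.2‖ ^ 2 := by
  linarith [angMom_sq_add_inner_sq z, sq_nonneg ⟪z.1, z.2⟫]

/-- The (double) energy of a state, for the potential smoothed with `ε² = b`. -/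
def energy (b : ℝ) (z : Plane × Plane) : ℝ := ‖z.2‖ ^ 2 + Real.log (‖z.1‖ ^ 2 + b)

theorem eq_initial_of_hasDerivWithinAt_zero {E : Type*} [NormedAddCommGroup E] [NormedSpace ℝ E]
    {f : ℝ → E} {τ : ℝ} (h : ∀ t ∈ Icc 0 τ, HasDerivWithinAt f 0 (Icc 0 τ) t) :
    ∀ t ∈ Icc 0 τ, f t = f 0 :=
  constant_of_has_deriv_right_zero (fun t ht => (h t ht).continuousWithinAt)
    fun t ht => (h t (Ico_subset_Icc_self ht)).mono_of_mem_nhdsWithin (Icc_mem_nhdsGE_of_mem ht)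

theorem hasDerivWithinAt_angMom {a b t : ℝ} {I : Set ℝ} {z : ℝ → Plane × Plane}
    (h : HasDerivWithinAt z (phaseField (attr a b) (z t)) I t) :
    HasDerivWithinAt (fun s => angMom (z s)) 0 I t := by
  have h1 : ∀ i, HasDerivWithinAt (fun s => (z s).1 i) ((z t).2 i) I t := fun i =>
    (EuclideanSpace.proj (𝕜 := ℝ) i).hasFDerivAt.comp_hasDerivWithinAt t
      (hasDerivWithinAt_phase_fst h)
  have h2 : ∀ i, HasDerivWithinAt (fun s => (z s).2 i) ((attr a b (z t).1) i) I t := fun i =>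
    (EuclideanSpace.proj (𝕜 := ℝ) i).hasFDerivAt.comp_hasDerivWithinAt t
      (hasDerivWithinAt_phase_snd h)
  refine (((h1 0).mul (h2 1)).sub ((h1 1).mul (h2 0))).congr_deriv ?_
  simp only [attr, PiLp.neg_apply, PiLp.smul_apply, smul_eq_mul]
  ring

theorem hasDerivWithinAt_energy {b t : ℝ} {I : Set ℝ} {z : ℝ → Plane × Plane}
    (hb : ‖(z t).1‖ ^ 2 + b ≠ 0)
    (h : HasDerivWithinAt z (phaseField (attr 0 b) (z t)) I t) :
    HasDerivWithinAt (fun s => energy b (z s)) 0 I t := by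
  have h1 := (hasDerivWithinAt_phase_fst h).norm_sq
  have h2 := (hasDerivWithinAt_phase_snd h).norm_sq
  refine (h2.add ((h1.add_const b).log hb)).congr_deriv ?_
  rw [attr_zero_left, inner_neg_right, inner_smul_right, real_inner_comm]
  field_simp
  ring

theorem IsRegularOn.angMom_eq {τ : ℝ} {z : ℝ → Plane × Plane} (h : IsRegularOn τ z) :
    ∀ t ∈ Icc 0 τ, angMom (z t) = angMom (z 0) :=
  eq_initial_of_hasDerivWithinAt_zero fun t ht => hasDerivWithinAt_angMom (h t ht).2

theorem IsRegularOn.energy_eq {τ : ℝ} {z : ℝ → Plane × Plane} (h : IsRegularOn τ z) :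
    ∀ t ∈ Icc 0 τ, energy 0 (z t) = energy 0 (z 0) :=
  eq_initial_of_hasDerivWithinAt_zero fun t ht => hasDerivWithinAt_energy
    (by simpa using (h t ht).1) (h t ht).2

theorem exists_first_hit {f : ℝ → ℝ} {T c : ℝ} (hf : ContinuousOn f (Icc 0 T)) (hT : 0 ≤ T)
    (h0 : c < f 0) (h1 : f T ≤ c) :
    ∃ s ∈ Ioc 0 T, f s = c ∧ ∀ t ∈ Ico 0 s, c < f t := by
  have hivt : ∀ t ∈ Icc 0 T, f t ≤ c → ∃ s ∈ Icc 0 t, f s = c := fun t ht htc =>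
    intermediate_value_Icc' ht.1 (hf.mono (Icc_subset_Icc_right ht.2)) ⟨htc, h0.le⟩
  have hcl : IsCompact (Icc 0 T ∩ f ⁻¹' {c}) :=
    isCompact_Icc.of_isClosed_subset (hf.preimage_isClosed_of_isClosed isClosed_Icc
      isClosed_singleton) inter_subset_left
  have hne : (Icc 0 T ∩ f ⁻¹' {c}).Nonempty := by
    obtain ⟨s, hs, hsc⟩ := hivt T ⟨hT, le_rfl⟩ h1
    exact ⟨s, hs, hsc⟩
  obtain ⟨s, ⟨hs, hsc⟩, hmin⟩ := hcl.exists_isLeast hne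
  have hsc : f s = c := hsc
  refine ⟨s, ⟨hs.1.lt_of_ne fun h => ?_, hs.2⟩, hsc, fun t ht => ?_⟩
  · rw [← h] at hsc; exact h0.ne' hsc
  · by_contra! hle
    obtain ⟨r, hr, hrc⟩ := hivt t ⟨ht.1, ht.2.le.trans hs.2⟩ hle
    have := hmin ⟨⟨hr.1, hr.2.trans (ht.2.le.trans hs.2)⟩, hrc⟩
    linarith [hr.2, ht.2]

/-! ### Global classical solutions with nonzero angular momentum -/

/-- Solve the field truncated at level `a` on `|u|²`. At a first arrival at this level the
conservation laws would give `ℓ² ≤ a(E - log a)`, so a level violating this inequality is never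
reached. -/
theorem exists_isRegularOn_of_angMom_ne_zero {ν : Plane × Plane} (hν : angMom ν ≠ 0) :
    ∃ z : ℝ → Plane × Plane, z 0 = ν ∧ ∀ τ, IsRegularOn τ z := by
  have hq : ν.1 ≠ 0 := by
    rintro h
    exact hν (by simp [angMom, h])
  have hlim : Tendsto (fun a : ℝ => energy 0 ν * a - a * Real.log a) (𝓝[>] 0) (𝓝 0) := by
    have : Continuous fun a : ℝ => energy 0 ν * a - a * Real.log a :=
      (continuous_const.mul continuous_id).sub Real.continuous_mul_log
    simpa using (this.tendsto 0).mono_left nhdsWithin_le_nhds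
  have hq2 : 0 < ‖ν.1‖ ^ 2 := pow_pos (norm_pos_iff.2 hq) 2
  obtain ⟨a, ⟨ha, haq⟩, ha0⟩ := ((hlim.eventually
    (gt_mem_nhds (pow_pos (abs_pos.2 hν) 2))).and
    ((eventually_lt_nhds hq2).filter_mono nhdsWithin_le_nhds)).and
      (self_mem_nhdsWithin (a := (0 : ℝ)) (s := Ioi 0)) |>.exists
  have ha0 : 0 < a := ha0
  rw [sq_abs] at ha
  obtain ⟨z, hz0, hz⟩ := exists_attr_solution (a := a) le_rfl (by simpa using ha0) ν
  have hzc : Continuous z := continuous_iff_continuousAt.2 fun t => (hz t).continuousAt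
  have hreg : ∀ τ, (∀ t ∈ Icc 0 τ, a ≤ ‖(z t).1‖ ^ 2) → IsRegularOn τ z := by
    refine fun τ h t ht => ⟨fun h0 => ?_, ?_⟩
    · have := h t ht
      rw [h0] at this
      simp at this
      linarith
    · have := (hz t).hasDerivWithinAt (s := Icc 0 τ)
      rwa [phaseField, attr_eq_of_le (h t ht), ← attr_zero_left] at this
  have hlow : ∀ t, 0 ≤ t → a < ‖(z t).1‖ ^ 2 := by
    by_contra! hcon
    obtain ⟨T, hT, hTa⟩ := hcon
    obtain ⟨s, hs, hsa, hlt⟩ := exists_first_hit (f := fun t => ‖(z t).1‖ ^ 2) (c := a)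
      (by fun_prop) hT (by rwa [hz0]) hTa
    have hr := hreg s fun t ht => by
      rcases ht.2.eq_or_lt with h | h
      · rw [h]; exact hsa.ge
      · exact (hlt t ⟨ht.1, h⟩).le
    have h1 := hr.angMom_eq s ⟨hs.1.le, le_rfl⟩
    have h2 := hr.energy_eq s ⟨hs.1.le, le_rfl⟩
    have h3 := angMom_sq_le (z s)
    have hsa : ‖(z s).1‖ ^ 2 = a := hsa
    rw [hz0] at h1 h2
    rw [h1, hsa] at h3
    rw [energy, hsa, add_zero] at h2
    rw [← h2] at ha
    nlinarith
  exact ⟨z, hz0, fun τ => hreg τ fun t ht => (hlow t ht.1).le⟩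

/-! ### Radial collisions -/

/-- `G` need not be onto: `g` is meaningful only on the range of `G`, which is open. -/
theorem exists_inverse_of_strictMono_of_hasDerivAt {G ρ : ℝ → ℝ} (hG : StrictMono G)
    (hd : ∀ w, HasDerivAt G (ρ w) w) (hρ : ∀ w, 0 < ρ w) :
    ∃ g : ℝ → ℝ, (∀ w, g (G w) = w) ∧ ∀ w, HasDerivAt g (ρ w)⁻¹ (G w) := by
  have hc : Continuous G := continuous_iff_continuousAt.2 fun w => (hd w).continuousAt
  have hleft : ∀ w, Function.invFun G (G w) = w := Function.leftInverse_invFun hG.injective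
  have hrange : ∀ w δ, 0 < δ → ∀ y ∈ Ioo (G (w - δ)) (G (w + δ)),
      ∃ x ∈ Ioo (w - δ) (w + δ), G x = y := fun w δ hδ y hy => by
    simpa using intermediate_value_Ioo (by linarith : w - δ ≤ w + δ) hc.continuousOn hy
  have hnhds : ∀ w δ, 0 < δ → Ioo (G (w - δ)) (G (w + δ)) ∈ 𝓝 (G w) := fun w δ hδ =>
    Ioo_mem_nhds (hG (by linarith)) (hG (by linarith))
  refine ⟨Function.invFun G, hleft, fun w => ?_⟩
  refine HasDerivAt.of_local_left_inverse (f := G) ?_ ?_ (hρ w).ne' ?_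
  · rw [ContinuousAt, hleft, Metric.tendsto_nhds]
    intro δ hδ
    filter_upwards [hnhds w δ hδ] with y hy
    obtain ⟨x, hx, rfl⟩ := hrange w δ hδ y hy
    rw [hleft, Real.dist_eq, abs_lt]
    constructor <;> linarith [hx.1, hx.2]
  · rw [hleft]; exact hd w
  · filter_upwards [hnhds w 1 one_pos] with y hy
    obtain ⟨x, hx, rfl⟩ := hrange w 1 one_pos y hy
    rw [hleft]

/-- `r` and `w = ṙ` describe a collision of the one-dimensional problem `r̈ = -1/r` at time `T`. -/
structure IsRadialCollision (T : ℝ) (r w : ℝ → ℝ) : Prop where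
  pos : 0 < T
  r_pos : ∀ t ∈ Ico 0 T, 0 < r t
  r_collision : r T = 0
  hasDerivAt_r : ∀ t ∈ Ico 0 T, HasDerivAt r (w t) t
  hasDerivAt_w : ∀ t ∈ Ico 0 T, HasDerivAt w (-(r t)⁻¹) t
  tendsto_r : Tendsto r (𝓝[<] T) (𝓝 0)
  tendsto_w : Tendsto w (𝓝[<] T) atBot

/-- Use the velocity `w` as parameter. Conservation of energy gives `r = ρ(w) = r₀ exp((w₀² -
w²)/2)`, and `ẇ = -1/r` gives `dt = -ρ(w) dw`. Thus `t = -G(w)`, and the Gaussian integral being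
finite, `w` reaches `-∞` at a finite time `T`. -/
theorem exists_isRadialCollision {r₀ : ℝ} (hr₀ : 0 < r₀) (w₀ : ℝ) :
    ∃ (T : ℝ) (r w : ℝ → ℝ), IsRadialCollision T r w ∧ r 0 = r₀ ∧ w 0 = w₀ := by
  set ρ : ℝ → ℝ := fun s => r₀ * Real.exp (w₀ ^ 2 / 2) * Real.exp (-(1 / 2) * s ^ 2) with hρ
  have hρ0 : ∀ s, 0 < ρ s := fun s => by positivity
  have hρc : Continuous ρ := by fun_prop
  have hρd : ∀ s, HasDerivAt ρ (-s * ρ s) s := fun s => by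
    have := (((hasDerivAt_pow 2 s).const_mul (-(1 / 2 : ℝ))).exp).const_mul
      (r₀ * Real.exp (w₀ ^ 2 / 2))
    refine this.congr_deriv ?_
    simp only [hρ]
    push_cast
    ring
  have hρi : MeasureTheory.Integrable ρ := (integrable_exp_neg_mul_sq (by norm_num)).const_mul _
  have hρlim : Tendsto ρ atBot (𝓝 0) := by
    have h1 : Tendsto (fun s : ℝ => -(1 / 2) * s ^ 2) atBot atBot := by
      refine Tendsto.const_mul_atTop_of_neg (by norm_num) ?_
      simpa [Function.comp_def] using
        (tendsto_pow_atTop (α := ℝ) two_ne_zero).comp tendsto_abs_atBot_atTop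
    have := (Real.tendsto_exp_atBot.comp h1).const_mul (r₀ * Real.exp (w₀ ^ 2 / 2))
    rwa [mul_zero] at this
  set G : ℝ → ℝ := fun w => ∫ s in w₀..w, ρ s with hGdef
  have hGd : ∀ w, HasDerivAt G (ρ w) w := fun w =>
    intervalIntegral.integral_hasDerivAt_right (hρc.intervalIntegrable _ _)
      (hρc.stronglyMeasurableAtFilter _ _) hρc.continuousAt
  have hGm : StrictMono G := strictMono_of_hasDerivAt_pos hGd hρ0
  have hGc : Continuous G := continuous_iff_continuousAt.2 fun w => (hGd w).continuousAt
  have hG0 : G w₀ = 0 := intervalIntegral.integral_same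
  have hGb : BddBelow (range G) := by
    refine ⟨-∫ s, ρ s, ?_⟩
    rintro _ ⟨w, rfl⟩
    rcases le_total w₀ w with h | h
    · have h1 : G w₀ ≤ G w := hGm.monotone h
      have h2 : 0 ≤ ∫ s, ρ s := MeasureTheory.integral_nonneg fun s => (hρ0 s).le
      linarith
    · rw [hGdef]
      simp only
      rw [intervalIntegral.integral_symm, intervalIntegral.integral_of_le h, neg_le_neg_iff]
      exact MeasureTheory.setIntegral_le_integral hρi (Eventually.of_forall fun s => (hρ0 s).le)
  obtain ⟨g, hg, hgd⟩ := exists_inverse_of_strictMono_of_hasDerivAt hGm hGd hρ0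
  set T : ℝ := -⨅ w, G w with hT
  have hGT : ∀ w, -T < G w := fun w => by
    have h1 := ciInf_le hGb (w - 1)
    have h2 : G (w - 1) < G w := hGm (by linarith)
    rw [hT, neg_neg]; linarith
  have hsurj : ∀ t ∈ Ico 0 T, ∃ w, G w = -t := fun t ht => by
    obtain ⟨w, hw⟩ := exists_lt_of_ciInf_lt (show ⨅ w, G w < -t by rw [hT] at ht; linarith [ht.2])
    have hww : w ≤ w₀ := hGm.le_iff_le.1 (by rw [hG0]; linarith [ht.1])
    obtain ⟨x, -, hx⟩ := intermediate_value_Icc hww hGc.continuousOn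
      ⟨hw.le, by rw [hG0]; linarith [ht.1]⟩
    exact ⟨x, hx⟩
  have hT0 : 0 < T := by have := hGT w₀; rw [hG0] at this; linarith
  have hwd : ∀ t ∈ Ico 0 T, HasDerivAt (fun t => g (-t)) (-(ρ (g (-t)))⁻¹) t := fun t ht => by
    obtain ⟨w, hw⟩ := hsurj t ht
    have h1 := hgd w
    rw [hw] at h1
    have h2 : g (-t) = w := by rw [← hw, hg]
    rw [h2]
    refine (HasDerivAt.comp t h1 (hasDerivAt_neg t)).congr_deriv ?_
    ring
  have hwlim : Tendsto (fun t => g (-t)) (𝓝[<] T) atBot := by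
    refine tendsto_atBot.2 fun A => ?_
    have h1 : max 0 (-G A) < T := max_lt hT0 (by linarith [hGT A])
    filter_upwards [Ioo_mem_nhdsLT h1] with t ht
    obtain ⟨w, hw⟩ := hsurj t ⟨(le_max_left _ _).trans ht.1.le, ht.2⟩
    rw [← hw, hg]
    refine hGm.le_iff_le.1 ?_
    rw [hw]
    linarith [(le_max_right 0 (-G A)).trans ht.1.le]
  -- From `T` on, `-t` is outside the range of `G` and `g (-t)` is meaningless; the indicator puts
  -- `r = 0` there.
  have hrw : ∀ t < T, (Iio T).indicator (fun t => ρ (g (-t))) t = ρ (g (-t)) := fun t ht =>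
    indicator_of_mem (mem_Iio.2 ht) _
  have hg0 : g 0 = w₀ := by rw [← hG0, hg]
  refine ⟨T, (Iio T).indicator fun t => ρ (g (-t)), fun t => g (-t),
    ⟨hT0, fun t ht => ?_, by simp, fun t ht => ?_, fun t ht => ?_, ?_, hwlim⟩, ?_, ?_⟩
  · rw [hrw t ht.2]; exact hρ0 _
  · have h := ((hρd _).comp t (hwd t ht))
    refine (h.congr_of_eventuallyEq ?_).congr_deriv ?_
    · filter_upwards [Iio_mem_nhds ht.2] with s hs using hrw s hs
    · have := (hρ0 (g (-t))).ne'
      field_simp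
  · rw [hrw t ht.2]; exact hwd t ht
  · refine (hρlim.comp hwlim).congr' ?_
    filter_upwards [self_mem_nhdsWithin] with s hs using (hrw s hs).symm
  · rw [hrw 0 hT0, neg_zero, hg0]
    simp only [hρ, mul_assoc, ← Real.exp_add]
    ring_nf
    simp
  · simp only [neg_zero, hg0]

theorem eq_smul_of_angMom_eq_zero {ν : Plane × Plane} (hq : ν.1 ≠ 0) (h : angMom ν = 0) :
    ν = (‖ν.1‖ • (‖ν.1‖⁻¹ • ν.1), (⟪ν.1, ν.2⟫ / ‖ν.1‖) • (‖ν.1‖⁻¹ • ν.1)) := by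
  have hn : ‖ν.1‖ ≠ 0 := norm_ne_zero_iff.2 hq
  refine Prod.ext (by simp [smul_smul, hn]) ?_
  have h1 : (‖ν.1‖ ^ 2) • ν.2 = ⟪ν.1, ν.2⟫ • ν.1 := by
    have h' : ν.1 0 * ν.2 1 = ν.1 1 * ν.2 0 := sub_eq_zero.1 h
    ext i
    simp only [EuclideanSpace.real_norm_sq_eq, PiLp.inner_apply, Fin.sum_univ_two, PiLp.smul_apply,
      smul_eq_mul]
    fin_cases i <;> simp
    · linear_combination (-(ν.1 1)) * h'
    · linear_combination (ν.1 0) * h'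
  have h2 : ν.2 = (‖ν.1‖ ^ 2)⁻¹ • (⟪ν.1, ν.2⟫ • ν.1) := by
    rw [← h1, smul_smul, inv_mul_cancel₀ (pow_ne_zero 2 hn), one_smul]
  change ν.2 = (⟪ν.1, ν.2⟫ / ‖ν.1‖) • (‖ν.1‖⁻¹ • ν.1)
  refine h2.trans ?_
  rw [smul_smul, smul_smul]
  congr 1
  field_simp

/-! ### Uniqueness and the shape of collision solutions -/

/-- Both curves are limits of the same smoothed family, so no Lipschitz bound for the singular field
is needed. -/
theorem IsRegularOn.eqOn {τ : ℝ} (hτ : 0 ≤ τ) {z y : ℝ → Plane × Plane} (hz : IsRegularOn τ z)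
    (hy : IsRegularOn τ y) (h0 : z 0 = y 0) : EqOn z y (Icc 0 τ) := fun t ht => by
  have h1 := (hz.tendstoUniformlyOn_smoothFamily hτ).tendsto_at ht
  have h2 := (hy.tendstoUniformlyOn_smoothFamily hτ).tendsto_at ht
  rw [h0] at h1
  exact tendsto_nhds_unique h1 h2

/-- The phase space trajectory on the line `ℝ e` with radial part `(r, w)`. -/
def radialState (e : Plane) (r w : ℝ → ℝ) (t : ℝ) : Plane × Plane := (r t • e, w t • e)

theorem phaseField_smul {e : Plane} (he : ‖e‖ = 1) {r : ℝ} (hr : r ≠ 0) (w : ℝ) :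
    phaseField (attr 0 0) (r • e, w • e) = (w • e, -r⁻¹ • e) := by
  simp only [phaseField, attr_zero_left, norm_smul, he, mul_one, add_zero, Real.norm_eq_abs, sq_abs,
    smul_smul, neg_smul]
  congr 3
  field_simp

theorem IsRadialCollision.isRegularOn {T : ℝ} {r w : ℝ → ℝ} (h : IsRadialCollision T r w)
    {e : Plane} (he : ‖e‖ = 1) {τ : ℝ} (hτ : τ < T) : IsRegularOn τ (radialState e r w) := by
  intro t ht
  have ht' : t ∈ Ico 0 T := ⟨ht.1, ht.2.trans_lt hτ⟩
  have hr := h.r_pos t ht'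
  refine ⟨smul_ne_zero hr.ne' (norm_ne_zero_iff.1 (by rw [he]; exact one_ne_zero)), ?_⟩
  rw [radialState, phaseField_smul he hr.ne']
  exact (((h.hasDerivAt_r t ht').smul_const e).prodMk
    ((h.hasDerivAt_w t ht').smul_const e)).hasDerivWithinAt

theorem IsRadialCollision.isCollisionSolution {T : ℝ} {r w : ℝ → ℝ} (h : IsRadialCollision T r w)
    {e : Plane} (he : ‖e‖ = 1) :
    IsCollisionSolution logPotential ⊤ (r 0 • e, w 0 • e) T fun t => r t • e := by
  have he0 : e ≠ 0 := norm_ne_zero_iff.1 (by rw [he]; exact one_ne_zero)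
  refine ⟨h.pos, ⟨⟨rfl, fun t => w t • e, rfl, fun t ht => ?_⟩,
    fun t ht => smul_ne_zero (h.r_pos t ht).ne' he0⟩, fun _ _ => le_top, ?_, ?_⟩
  · have hr := h.r_pos t ht
    have hf := congrArg Prod.snd (phaseField_smul he hr.ne' (w t))
    rw [force_logPotential (smul_ne_zero hr.ne' he0), show attr 0 0 (r t • e) = _ from hf]
    exact ⟨((h.hasDerivAt_r t ht).smul_const e).hasDerivWithinAt,
      ((h.hasDerivAt_w t ht).smul_const e).hasDerivWithinAt⟩
  · simpa using h.tendsto_r.smul_const e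
  · simp [h.r_collision]

theorem exists_isRadialCollision_of_angMom_eq_zero {ν : Plane × Plane} (hq : ν.1 ≠ 0)
    (h : angMom ν = 0) : ∃ (e : Plane) (T : ℝ) (r w : ℝ → ℝ), ‖e‖ = 1 ∧
      IsRadialCollision T r w ∧ ν = (r 0 • e, w 0 • e) := by
  obtain ⟨T, r, w, hrw, hr, hw⟩ := exists_isRadialCollision (norm_pos_iff.2 hq)
    (⟪ν.1, ν.2⟫ / ‖ν.1‖)
  refine ⟨‖ν.1‖⁻¹ • ν.1, T, r, w, ?_, hrw, ?_⟩
  · rw [norm_smul, norm_inv, norm_norm, inv_mul_cancel₀ (norm_ne_zero_iff.2 hq)]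
  · rw [hr, hw]; exact eq_smul_of_angMom_eq_zero hq h

theorem IsCollisionSolution.exists_phase {ν : Plane × Plane} {T : ℝ} {u : ℝ → Plane}
    (h : IsCollisionSolution logPotential ⊤ ν T u) :
    ∃ z : ℝ → Plane × Plane, z 0 = ν ∧ (∀ t, (z t).1 = u t) ∧ ∀ τ < T, IsRegularOn τ z := by
  obtain ⟨hT, ⟨hsol, hne⟩, -, -, -⟩ := h
  obtain ⟨z, hz0, hzu, hz⟩ := hsol.exists_phase
  refine ⟨z, hz0, hzu, fun τ hτ t ht => ?_⟩
  have ht' : t ∈ Ico 0 T := ⟨ht.1, ht.2.trans_lt hτ⟩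
  have hne' : (z t).1 ≠ 0 := by rw [hzu]; exact hne t ht'
  refine ⟨hne', ?_⟩
  have := (hz t ht').mono (Icc_subset_Ico_right hτ)
  rwa [phaseField, force_logPotential hne'] at this

theorem IsCollisionSolution.fst_ne_zero {ν : Plane × Plane} {T : ℝ} {u : ℝ → Plane}
    (h : IsCollisionSolution logPotential ⊤ ν T u) : ν.1 ≠ 0 := by
  obtain ⟨hT, ⟨hsol, hne⟩, -⟩ := h
  rw [← hsol.1]
  exact hne 0 ⟨le_rfl, hT⟩

/-- Pass to the limit `|u| → 0` in `ℓ² ≤ |u|²(E - log |u|²)`. -/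
theorem IsCollisionSolution.angMom_eq_zero {ν : Plane × Plane} {T : ℝ} {u : ℝ → Plane}
    (h : IsCollisionSolution logPotential ⊤ ν T u) : angMom ν = 0 := by
  obtain ⟨z, hz0, hzu, hz⟩ := h.exists_phase
  obtain ⟨hT, -, -, hlim, -⟩ := h
  have h1 : Tendsto (fun t => ‖u t‖ ^ 2) (𝓝[<] T) (𝓝 0) := by
    simpa using hlim.norm.pow 2
  have h2 : Tendsto (fun t => ‖u t‖ ^ 2 * energy 0 ν - ‖u t‖ ^ 2 * Real.log (‖u t‖ ^ 2))
      (𝓝[<] T) (𝓝 0) := by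
    have h3 := (Real.continuous_mul_log.tendsto 0).comp h1
    simpa [Function.comp_def] using (h1.mul_const (energy 0 ν)).sub h3
  have h4 : angMom ν ^ 2 ≤ 0 := by
    refine ge_of_tendsto h2 ?_
    filter_upwards [Ioo_mem_nhdsLT hT] with t ht
    have ht' : t ∈ Icc 0 t := ⟨ht.1.le, le_rfl⟩
    have h5 := (hz t ht.2).angMom_eq t ht'
    have h6 := (hz t ht.2).energy_eq t ht'
    have h7 := angMom_sq_le (z t)
    rw [h5, hz0, hzu] at h7
    rw [hz0, energy, hzu, add_zero] at h6
    rw [← mul_sub, ← h6]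
    simpa using h7
  exact pow_eq_zero_iff two_ne_zero |>.1 (le_antisymm h4 (sq_nonneg _))

/-- The two solutions agree before `T`. If `T < S`, then `v` would be continuous and nonzero at `T`,
yet tend to `0` there. -/
theorem IsCollisionSolution.eqOn {ν : Plane × Plane} {T S : ℝ} {u v : ℝ → Plane}
    (hu : IsCollisionSolution logPotential ⊤ ν T u)
    (hv : IsCollisionSolution logPotential ⊤ ν S v) (hTS : T ≤ S) :
    T = S ∧ EqOn u v (Icc 0 T) := by
  obtain ⟨z, hz0, hzu, hz⟩ := hu.exists_phase
  obtain ⟨y, hy0, hyv, hy⟩ := hv.exists_phase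
  have heq : EqOn u v (Ico 0 T) := fun t ht => by
    rw [← hzu, ← hyv, (hz t ht.2).eqOn ht.1 (hy t (ht.2.trans_le hTS)) (hz0.trans hy0.symm)
      ⟨ht.1, le_rfl⟩]
  have hS : T = S := by
    refine hTS.eq_of_not_lt fun hlt => ?_
    have h1 : ContinuousWithinAt v (Ico 0 S) T := by
      obtain ⟨_, ⟨⟨_, _, _, h⟩, _⟩, _⟩ := hv
      exact (h T ⟨hu.1.le, hlt⟩).1.continuousWithinAt
    have h2 : Tendsto v (𝓝[<] T) (𝓝 (v T)) := by
      refine h1.mono_left ?_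
      rw [← nhdsWithin_Ioo_eq_nhdsLT hu.1]
      exact nhdsWithin_mono _ fun t ht => ⟨ht.1.le, ht.2.trans hlt⟩
    have h3 : Tendsto v (𝓝[<] T) (𝓝 0) := by
      refine hu.2.2.2.1.congr' ?_
      filter_upwards [Ioo_mem_nhdsLT hu.1] with t ht using heq ⟨ht.1.le, ht.2⟩
    exact hv.2.1.2 T ⟨hu.1.le, hlt⟩ (tendsto_nhds_unique h2 h3)
  refine ⟨hS, fun t ht => ?_⟩
  rcases ht.2.eq_or_lt with h | h
  · rw [h, hu.2.2.2.2, hS, hv.2.2.2.2]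
  · exact heq ⟨ht.1, h⟩

theorem IsCollisionSolution.exists_radial {ν : Plane × Plane} {T : ℝ} {u : ℝ → Plane}
    (h : IsCollisionSolution logPotential ⊤ ν T u) :
    ∃ (e : Plane) (r w : ℝ → ℝ), ‖e‖ = 1 ∧ IsRadialCollision T r w ∧
      ν = (r 0 • e, w 0 • e) ∧ ∀ t ∈ Icc 0 T, u t = r t • e := by
  obtain ⟨e, S, r, w, he, hrw, hν⟩ :=
    exists_isRadialCollision_of_angMom_eq_zero h.fst_ne_zero h.angMom_eq_zero
  have h2 := hrw.isCollisionSolution he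
  rw [← hν] at h2
  rcases le_total T S with hTS | hTS
  · obtain ⟨rfl, heq⟩ := h.eqOn h2 hTS
    exact ⟨e, r, w, he, hrw, hν, heq⟩
  · obtain ⟨rfl, heq⟩ := h2.eqOn h hTS
    exact ⟨e, r, w, he, hrw, hν, heq.symm⟩

/-! ### The pericentre of a smoothed trajectory -/

theorem norm_sq_normalized_deriv {E : Type*} [NormedAddCommGroup E] [InnerProductSpace ℝ E]
    {x y : E} (hx : x ≠ 0) :
    ‖‖x‖⁻¹ • y - (⟪x, y⟫ / ‖x‖ ^ 3) • x‖ ^ 2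
      = (‖x‖ ^ 2 * ‖y‖ ^ 2 - ⟪x, y⟫ ^ 2) / ‖x‖ ^ 4 := by
  have hn : ‖x‖ ≠ 0 := norm_ne_zero_iff.2 hx
  rw [norm_sub_sq_real, norm_smul, norm_smul, mul_pow, mul_pow, Real.norm_eq_abs, Real.norm_eq_abs,
    sq_abs, sq_abs, inner_smul_left, inner_smul_right, real_inner_comm]
  simp only [conj_trivial]
  field_simp
  ring

theorem hasDerivAt_normalized {E : Type*} [NormedAddCommGroup E] [InnerProductSpace ℝ E]
    {f : ℝ → E} {f' : E} {t : ℝ} (h : HasDerivAt f f' t) (h0 : f t ≠ 0) :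
    HasDerivAt (fun s => ‖f s‖⁻¹ • f s) (‖f t‖⁻¹ • f' - (⟪f t, f'⟫ / ‖f t‖ ^ 3) • f t) t := by
  have hn : ‖f t‖ ≠ 0 := norm_ne_zero_iff.2 h0
  have h1 : HasDerivAt (fun s => ‖f s‖) (⟪f t, f'⟫ / ‖f t‖) t := by
    have h2 := h.norm_sq.sqrt (pow_ne_zero 2 hn)
    simp only [Real.sqrt_sq (norm_nonneg _)] at h2
    refine h2.congr_deriv ?_
    field_simp
  refine ((h1.inv hn).smul h).congr_deriv ?_
  have e : -(⟪f t, f'⟫ / ‖f t‖) / ‖f t‖ ^ 2 = -(⟪f t, f'⟫ / ‖f t‖ ^ 3) := by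
    field_simp
  rw [e, neg_smul, sub_eq_add_neg]
  rfl

theorem hasDerivAt_smoothFlow_fst {ε : ℝ} (hε : 0 < ε) (ν : Plane × Plane) (t : ℝ) :
    HasDerivAt (fun s => (smoothFlow ε ν s).1) (smoothFlow ε ν t).2 t :=
  hasDerivWithinAt_univ.1 (hasDerivWithinAt_phase_fst
    (hasDerivAt_smoothFlow hε ν t).hasDerivWithinAt)

theorem hasDerivAt_smoothFlow_snd {ε : ℝ} (hε : 0 < ε) (ν : Plane × Plane) (t : ℝ) :
    HasDerivAt (fun s => (smoothFlow ε ν s).2) (attr 0 (ε ^ 2) (smoothFlow ε ν t).1) t :=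
  hasDerivWithinAt_univ.1 (hasDerivWithinAt_phase_snd
    (hasDerivAt_smoothFlow hε ν t).hasDerivWithinAt)

theorem smoothFlow_angMom {ε : ℝ} (hε : 0 < ε) (ν : Plane × Plane) {t : ℝ} (ht : 0 ≤ t) :
    angMom (smoothFlow ε ν t) = angMom ν := by
  have := eq_initial_of_hasDerivWithinAt_zero (τ := t) (fun s _ => hasDerivWithinAt_angMom
    (hasDerivAt_smoothFlow hε ν s).hasDerivWithinAt) t ⟨ht, le_rfl⟩
  rwa [smoothFlow_zero] at this

theorem smoothFlow_energy {ε : ℝ} (hε : 0 < ε) (ν : Plane × Plane) {t : ℝ} (ht : 0 ≤ t) :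
    energy (ε ^ 2) (smoothFlow ε ν t) = energy (ε ^ 2) ν := by
  have := eq_initial_of_hasDerivWithinAt_zero (τ := t) (fun s _ => hasDerivWithinAt_energy
    (z := smoothFlow ε ν) (b := ε ^ 2) (by positivity)
    (hasDerivAt_smoothFlow hε ν s).hasDerivWithinAt) t ⟨ht, le_rfl⟩
  rwa [smoothFlow_zero] at this

/-- Half the derivative of `|u|²`. -/
def radialMom (z : Plane × Plane) : ℝ := ⟪z.1, z.2⟫

theorem hasDerivAt_radialMom {ε : ℝ} (hε : 0 < ε) (ν : Plane × Plane) (t : ℝ) :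
    HasDerivAt (fun s => radialMom (smoothFlow ε ν s))
      (‖(smoothFlow ε ν t).2‖ ^ 2
        - ‖(smoothFlow ε ν t).1‖ ^ 2 / (‖(smoothFlow ε ν t).1‖ ^ 2 + ε ^ 2)) t := by
  refine ((hasDerivAt_smoothFlow_fst hε ν t).inner ℝ
    (hasDerivAt_smoothFlow_snd hε ν t)).congr_deriv ?_
  rw [attr_zero_left, inner_neg_right, inner_smul_right, real_inner_self_eq_norm_sq,
    real_inner_self_eq_norm_sq]
  ring

theorem sub_one_le_radialMom_deriv {ε : ℝ} (hε : 0 < ε) (z : Plane × Plane) :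
    ‖z.2‖ ^ 2 - 1 ≤ ‖z.2‖ ^ 2 - ‖z.1‖ ^ 2 / (‖z.1‖ ^ 2 + ε ^ 2) := by
  have : ‖z.1‖ ^ 2 / (‖z.1‖ ^ 2 + ε ^ 2) ≤ 1 := by
    rw [div_le_one (by positivity)]
    nlinarith
  linarith

/-- While the motion is inward `|u|` decreases, and conservation of energy then makes the speed
increase. -/
theorem norm_le_of_radialMom_nonpos {ε : ℝ} (hε : 0 < ε) {ν : Plane × Plane} {τ : ℝ}
    (h : ∀ t ∈ Ico 0 τ, radialMom (smoothFlow ε ν t) ≤ 0) :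
    ∀ t ∈ Icc 0 τ, ‖(smoothFlow ε ν t).1‖ ≤ ‖ν.1‖ ∧ ‖ν.2‖ ≤ ‖(smoothFlow ε ν t).2‖ := by
  intro t ht
  have hd : ∀ s, HasDerivAt (fun s => ‖(smoothFlow ε ν s).1‖ ^ 2)
      (2 * radialMom (smoothFlow ε ν s)) s := fun s => (hasDerivAt_smoothFlow_fst hε ν s).norm_sq
  have h1 : ‖(smoothFlow ε ν t).1‖ ^ 2 ≤ ‖ν.1‖ ^ 2 := by
    have hanti : AntitoneOn (fun s => ‖(smoothFlow ε ν s).1‖ ^ 2) (Icc 0 τ) := by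
      refine antitoneOn_of_deriv_nonpos (convex_Icc 0 τ)
        (fun s _ => (hd s).continuousAt.continuousWithinAt)
        (fun s _ => (hd s).differentiableAt.differentiableWithinAt) fun s hs => ?_
      rw [interior_Icc] at hs
      rw [(hd s).deriv]
      linarith [h s (Ioo_subset_Ico_self hs)]
    have := hanti ⟨le_rfl, ht.1.trans ht.2⟩ ht ht.1
    simpa only [smoothFlow_zero] using this
  refine ⟨le_of_sq_le_sq h1 (norm_nonneg _), ?_⟩
  have h2 := smoothFlow_energy hε ν ht.1
  rw [energy, energy] at h2
  have h3 : Real.log (‖(smoothFlow ε ν t).1‖ ^ 2 + ε ^ 2) ≤ Real.log (‖ν.1‖ ^ 2 + ε ^ 2) :=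
    Real.log_le_log (by positivity) (by linarith)
  exact le_of_sq_le_sq (by linarith) (norm_nonneg _)

/-- As long as the motion is inward, `u·v` grows at rate at least `|p|² - 1`. It starts above
`-|q||p|`, and `|p| ≤ 2(|p|² - 1)` once `|p|² ≥ 2`, so it vanishes by time `2|q|`. -/
theorem exists_pericentre_time {ε : ℝ} (hε : 0 < ε) {ν : Plane × Plane} (hf : radialMom ν < 0)
    (hp : 2 ≤ ‖ν.2‖ ^ 2) :
    ∃ s, 0 < s ∧ s ≤ 2 * ‖ν.1‖ ∧ radialMom (smoothFlow ε ν s) = 0 ∧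
      ∀ t ∈ Ico 0 s, radialMom (smoothFlow ε ν t) < 0 := by
  have hp0 : 1 ≤ ‖ν.2‖ := by nlinarith [norm_nonneg ν.2]
  set S : ℝ := 2 * ‖ν.1‖ with hS
  have hcont : Continuous fun t => -radialMom (smoothFlow ε ν t) :=
    continuous_iff_continuousAt.2 fun t => (hasDerivAt_radialMom hε ν t).continuousAt.neg
  have hex : ∃ T ∈ Icc 0 S, 0 ≤ radialMom (smoothFlow ε ν T) := by
    by_contra! hneg
    have hle := norm_le_of_radialMom_nonpos hε (τ := S)
      fun t ht => (hneg t (Ico_subset_Icc_self ht)).le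
    have hd : ∀ t, HasDerivAt
        (fun t => radialMom (smoothFlow ε ν t) - (‖ν.2‖ ^ 2 - 1) * t) _ t := fun t =>
      (hasDerivAt_radialMom hε ν t).sub ((hasDerivAt_id t).const_mul (‖ν.2‖ ^ 2 - 1))
    have hmono : MonotoneOn
        (fun t => radialMom (smoothFlow ε ν t) - (‖ν.2‖ ^ 2 - 1) * t) (Icc 0 S) := by
      refine monotoneOn_of_deriv_nonneg (convex_Icc 0 S)
        (fun s _ => (hd s).continuousAt.continuousWithinAt)
        (fun s _ => (hd s).differentiableAt.differentiableWithinAt) fun s hs => ?_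
      rw [interior_Icc] at hs
      rw [(hd s).deriv]
      have h1 := sub_one_le_radialMom_deriv hε (smoothFlow ε ν s)
      have h2 := (hle s (Ioo_subset_Icc_self hs)).2
      have h3 : ‖ν.2‖ ^ 2 ≤ ‖(smoothFlow ε ν s).2‖ ^ 2 := by gcongr
      linarith
    have hS0 : 0 ≤ S := by positivity
    have h1 := hmono ⟨le_rfl, hS0⟩ ⟨hS0, le_rfl⟩ hS0
    simp only [smoothFlow_zero, mul_zero, sub_zero] at h1
    have h2 := hneg S ⟨hS0, le_rfl⟩
    have h3 : -(‖ν.1‖ * ‖ν.2‖) ≤ radialMom ν := neg_le_of_abs_le (abs_real_inner_le_norm _ _)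
    have h4 : ‖ν.1‖ * ‖ν.2‖ ≤ ‖ν.1‖ * (2 * (‖ν.2‖ ^ 2 - 1)) := by
      gcongr
      nlinarith
    rw [hS] at h1
    nlinarith
  obtain ⟨T, hT, hT0⟩ := hex
  obtain ⟨s, hs, hs0, hlt⟩ := exists_first_hit (c := 0) (T := T) hcont.continuousOn hT.1
    (by simpa using hf) (by simpa using hT0)
  exact ⟨s, hs.1, hs.2.trans hT.2, by simpa using hs0, fun t ht => by simpa using hlt t ht⟩

/-- The direction of the velocity hardly changes until the pericentre. -/
theorem norm_direction_sub_le {ε : ℝ} (hε : 0 < ε) {ν : Plane × Plane} (hp : 2 ≤ ‖ν.2‖ ^ 2)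
    {s : ℝ} (hs : 0 < s) (hs0 : radialMom (smoothFlow ε ν s) = 0)
    (hneg : ∀ t ∈ Ico 0 s, radialMom (smoothFlow ε ν t) < 0) :
    ‖‖(smoothFlow ε ν s).2‖⁻¹ • (smoothFlow ε ν s).2 - ‖ν.2‖⁻¹ • ν.2‖
      ≤ Real.pi / 2 / (‖ν.2‖ ^ 2 - 1) := by
  have hle := norm_le_of_radialMom_nonpos hε (τ := s) fun t ht => (hneg t ht).le
  have hv2 : ∀ t ∈ Icc 0 s, ‖ν.2‖ ^ 2 ≤ ‖(smoothFlow ε ν t).2‖ ^ 2 := fun t ht => by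
    have := (hle t ht).2
    gcongr
  have hv : ∀ t ∈ Icc 0 s, 0 < ‖(smoothFlow ε ν t).2‖ := fun t ht => by
    have := hv2 t ht
    by_contra! h
    have h' := le_antisymm h (norm_nonneg _)
    rw [h'] at this
    linarith
  have hder : ∀ t ∈ Icc 0 s, ∃ n' : Plane, HasDerivAt
      (fun t => ‖(smoothFlow ε ν t).2‖⁻¹ • (smoothFlow ε ν t).2) n' t ∧
      ‖n'‖ = |angMom ν| / ((‖(smoothFlow ε ν t).1‖ ^ 2 + ε ^ 2) * ‖(smoothFlow ε ν t).2‖ ^ 2) := by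
    intro t ht
    have hv0 := norm_pos_iff.1 (hv t ht)
    refine ⟨_, hasDerivAt_normalized (hasDerivAt_smoothFlow_snd hε ν t) hv0, ?_⟩
    have h1 := norm_sq_normalized_deriv (y := attr 0 (ε ^ 2) (smoothFlow ε ν t).1) hv0
    have h2 := angMom_sq_add_inner_sq (smoothFlow ε ν t)
    rw [smoothFlow_angMom hε ν ht.1] at h2
    have h3 : 0 < ‖(smoothFlow ε ν t).1‖ ^ 2 + ε ^ 2 := by positivity
    have h4 := hv t ht
    refine (sq_eq_sq₀ (norm_nonneg _) (by positivity)).1 ?_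
    rw [h1, attr_zero_left, norm_neg, norm_smul, inner_neg_right, inner_smul_right,
      norm_inv, Real.norm_of_nonneg h3.le, real_inner_comm, div_pow, sq_abs]
    field_simp
    linarith
  choose! n' hn' hn'norm using hder
  set n : ℝ → Plane := fun t => ‖(smoothFlow ε ν t).2‖⁻¹ • (smoothFlow ε ν t).2 with hn
  have hn0 : n 0 = ‖ν.2‖⁻¹ • ν.2 := by simp [hn]
  have hs' : s ∈ Icc 0 s := ⟨hs.le, le_rfl⟩
  have hpi : 0 ≤ Real.pi / 2 / (‖ν.2‖ ^ 2 - 1) :=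
    div_nonneg (by positivity) (by linarith)
  rw [← hn0]
  change ‖n s - n 0‖ ≤ _
  -- The comparison function below divides by `|ℓ|`; for `ℓ = 0` the direction is constant.
  by_cases hℓ : angMom ν = 0
  · have : n s = n 0 := by
      refine eq_initial_of_hasDerivWithinAt_zero (fun t ht => ?_) s hs'
      have h1 := hn'norm t ht
      rw [hℓ, abs_zero, zero_div, norm_eq_zero] at h1
      exact h1 ▸ (hn' t ht).hasDerivWithinAt
    rw [this, sub_self, norm_zero]
    exact hpi
  · have hℓ0 : 0 < |angMom ν| := abs_pos.2 hℓ
    have hK : 0 < ‖ν.2‖ ^ 2 - 1 := by linarith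
    -- With `m = u·v`, the turning rate is at most `|ℓ|/(|u|²|v|²) = |ℓ|/(ℓ² + m²)`. Since `m' ≥
    -- |p|² - 1`, this is dominated by the derivative of `arctan(m/|ℓ|)/(|p|² - 1)`. As `m` rises to
    -- `0`, the arctangent gains at most `π/2`, whatever `ℓ` is.
    have hB : ∀ t, HasDerivAt (fun t => (‖ν.2‖ ^ 2 - 1)⁻¹ *
        (Real.arctan (radialMom (smoothFlow ε ν t) / |angMom ν|)
          - Real.arctan (radialMom ν / |angMom ν|))) _ t := fun t =>
      ((((hasDerivAt_radialMom hε ν t).div_const |angMom ν|).arctan).sub_const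
        (Real.arctan (radialMom ν / |angMom ν|))).const_mul (‖ν.2‖ ^ 2 - 1)⁻¹
    have key := image_norm_le_of_norm_deriv_right_le_deriv_boundary (a := 0) (b := s)
      (f := fun t => n t - n 0) (f' := n')
      (fun t ht => ((hn' t ht).continuousAt.sub continuousAt_const).continuousWithinAt)
      (fun t ht => ((hn' t (Ico_subset_Icc_self ht)).sub_const (n 0)).hasDerivWithinAt)
      (by simp) hB (fun t ht => ?_) hs'
    · refine key.trans ?_
      rw [hs0, zero_div, Real.arctan_zero, zero_sub, inv_mul_eq_div]
      gcongr
      linarith [Real.neg_pi_div_two_lt_arctan (radialMom ν / |angMom ν|)]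
    · have ht' := Ico_subset_Icc_self ht
      rw [hn'norm t ht']
      have h1 := angMom_sq_add_inner_sq (smoothFlow ε ν t)
      rw [smoothFlow_angMom hε ν ht.1] at h1
      have h2 := sub_one_le_radialMom_deriv hε (smoothFlow ε ν t)
      have h3 := hv2 t ht'
      have h4 := hv t ht'
      set D := ‖(smoothFlow ε ν t).2‖ ^ 2
        - ‖(smoothFlow ε ν t).1‖ ^ 2 / (‖(smoothFlow ε ν t).1‖ ^ 2 + ε ^ 2) with hD
      have hu : 0 < ‖(smoothFlow ε ν t).1‖ ^ 2 := by
        refine lt_of_le_of_ne (by positivity) fun h => ?_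
        rw [← h, zero_mul] at h1
        have : 0 < angMom ν ^ 2 := by positivity
        nlinarith [sq_nonneg ⟪(smoothFlow ε ν t).1, (smoothFlow ε ν t).2⟫]
      have e : (‖ν.2‖ ^ 2 - 1)⁻¹ * (1 / (1 + (radialMom (smoothFlow ε ν t) / |angMom ν|) ^ 2)
          * (D / |angMom ν|)) = (D / (‖ν.2‖ ^ 2 - 1)) *
          (|angMom ν| / (‖(smoothFlow ε ν t).1‖ ^ 2 * ‖(smoothFlow ε ν t).2‖ ^ 2)) := by
        rw [← h1, div_pow, sq_abs, radialMom, ← sq_abs (angMom ν)]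
        field_simp
      rw [e]
      have h5 : 1 ≤ D / (‖ν.2‖ ^ 2 - 1) := by rw [one_le_div hK]; linarith
      calc |angMom ν| / ((‖(smoothFlow ε ν t).1‖ ^ 2 + ε ^ 2) * ‖(smoothFlow ε ν t).2‖ ^ 2)
          ≤ |angMom ν| / (‖(smoothFlow ε ν t).1‖ ^ 2 * ‖(smoothFlow ε ν t).2‖ ^ 2) := by
            gcongr; nlinarith
        _ ≤ _ := le_mul_of_one_le_left (by positivity) h5

/-! ### The symmetry about the pericentre -/

/-- The equation is invariant under time reversal and linear isometries. At a pericentre `u ⊥ v`, so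
the reflection in the line of `v` fixes `v` and negates `u`; the reversed and reflected curve
therefore has the same initial datum. -/
theorem smoothFlow_reflection {ε : ℝ} (hε : 0 < ε) {ν : Plane × Plane} (h : radialMom ν = 0)
    (t : ℝ) :
    smoothFlow ε ν t = (-(ℝ ∙ ν.2).reflection (smoothFlow ε ν (-t)).1,
      (ℝ ∙ ν.2).reflection (smoothFlow ε ν (-t)).2) := by
  set Q := (ℝ ∙ ν.2).reflection with hQ
  have h1 : Q ν.1 = -ν.1 := Submodule.reflection_mem_subspace_orthogonalComplement_eq_neg
    (Submodule.mem_orthogonal_singleton_iff_inner_left.2 h)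
  have h2 : Q ν.2 = ν.2 :=
    Submodule.reflection_mem_subspace_eq_self (Submodule.mem_span_singleton_self _)
  have hQd : ∀ {f : ℝ → Plane} {f' : Plane} {s : ℝ}, HasDerivAt f f' s →
      HasDerivAt (fun s => Q (f s)) (Q f') s := fun hf =>
    (Q.toContinuousLinearEquiv : Plane →L[ℝ] Plane).hasFDerivAt.comp_hasDerivAt _ hf
  have hz := eq_smoothFlow hε
    (z := fun t => (-Q (smoothFlow ε ν (-t)).1, Q (smoothFlow ε ν (-t)).2)) fun s => ?_
  · have := congrFun hz t
    simp only [neg_zero, smoothFlow_zero, h1, h2, neg_neg] at this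
    exact this.symm
  · have h3 := (hasDerivAt_smoothFlow_fst hε ν (-s)).scomp s (hasDerivAt_neg s)
    have h4 := (hasDerivAt_smoothFlow_snd hε ν (-s)).scomp s (hasDerivAt_neg s)
    refine ((hQd h3).neg.prodMk (hQd h4)).congr_deriv ?_
    simp [phaseField, attr_neg, attr_map]

theorem smoothFlow_add_reflection {ε : ℝ} (hε : 0 < ε) {ν : Plane × Plane} {s : ℝ}
    (h : radialMom (smoothFlow ε ν s) = 0) (t : ℝ) :
    smoothFlow ε ν (s + t) = (-(ℝ ∙ (smoothFlow ε ν s).2).reflection (smoothFlow ε ν (s - t)).1,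
      (ℝ ∙ (smoothFlow ε ν s).2).reflection (smoothFlow ε ν (s - t)).2) := by
  rw [smoothFlow_add hε, smoothFlow_reflection hε h, ← smoothFlow_add hε, ← sub_eq_add_neg]

theorem norm_reflection_sub_le {E : Type*} [NormedAddCommGroup E] [InnerProductSpace ℝ E]
    (v e : E) : ‖(ℝ ∙ v).reflection e - e‖ ≤ 2 * ‖‖v‖⁻¹ • v - e‖ := by
  have h : (ℝ ∙ v).reflection (‖v‖⁻¹ • v) = ‖v‖⁻¹ • v :=
    Submodule.reflection_mem_subspace_eq_self
      (Submodule.smul_mem _ _ (Submodule.mem_span_singleton_self _))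
  have e1 : (ℝ ∙ v).reflection e - e
      = (‖v‖⁻¹ • v - e) - (ℝ ∙ v).reflection (‖v‖⁻¹ • v - e) := by
    rw [map_sub, h]; abel
  rw [e1]
  refine (norm_sub_le _ _).trans ?_
  rw [LinearIsometryEquiv.norm_map]
  linarith

/-! ### Passing through a collision -/

/-- The signed radius of the transmitted motion on `[0, 2 T]`. -/
def transmitted (T : ℝ) (r : ℝ → ℝ) (t : ℝ) : ℝ := if t ≤ T then r t else -r (2 * T - t)

namespace IsRadialCollision

variable {T : ℝ} {r w : ℝ → ℝ}

theorem transmitted_reflect (h : IsRadialCollision T r w) (t : ℝ) :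
    transmitted T r (2 * T - t) = -transmitted T r t := by
  rcases lt_trichotomy t T with ht | rfl | ht
  · rw [transmitted, transmitted, if_neg (by linarith), if_pos ht.le, sub_sub_cancel]
  · rw [transmitted, transmitted, if_pos (by linarith), if_pos le_rfl, two_mul, add_sub_cancel_right,
      h.r_collision, neg_zero]
  · rw [transmitted, transmitted, if_pos (by linarith), if_neg (by linarith), neg_neg]

theorem continuousOn_r (h : IsRadialCollision T r w) : ContinuousOn r (Icc 0 T) := by
  intro t ht
  rcases ht.2.eq_or_lt with rfl | hlt
  · refine (continuousWithinAt_Iio_iff_Iic.1 ?_).mono Icc_subset_Iic_self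
    rw [ContinuousWithinAt, h.r_collision]
    exact h.tendsto_r
  · exact (h.hasDerivAt_r t ⟨ht.1, hlt⟩).continuousAt.continuousWithinAt

theorem continuousOn_transmitted (h : IsRadialCollision T r w) :
    ContinuousOn (transmitted T r) (Icc 0 (2 * T)) := by
  have hT := h.pos
  have h1 : ContinuousOn (transmitted T r) (Icc 0 T) :=
    h.continuousOn_r.congr fun t ht => if_pos ht.2
  have h2 : ContinuousOn (transmitted T r) (Icc T (2 * T)) := by
    have h3 : ContinuousOn (fun t => -transmitted T r (2 * T - t)) (Icc T (2 * T)) :=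
      (h1.comp (by fun_prop) fun t ht => ⟨by linarith [ht.2], by linarith [ht.1]⟩).neg
    refine h3.congr fun t _ => ?_
    simp only [h.transmitted_reflect, neg_neg]
  rw [← Icc_union_Icc_eq_Icc hT.le (by linarith : T ≤ 2 * T)]
  exact h1.union_of_isClosed h2 isClosed_Icc isClosed_Icc

theorem tendstoUniformlyOn_smoothFamily (h : IsRadialCollision T r w) {e : Plane} (he : ‖e‖ = 1)
    {τ : ℝ} (h0 : 0 ≤ τ) (hτ : τ < T) :
    TendstoUniformlyOn smoothFamily (radialState e r w)
      (smoothingFilter (radialState e r w 0)) (Icc 0 τ) :=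
  (h.isRegularOn he hτ).tendstoUniformlyOn_smoothFamily h0

/-- Up to the pericentre, the trajectories of the smoothed problem follow the collision solution. -/
theorem eventually_exists_pericentre (h : IsRadialCollision T r w) {e : Plane} (he : ‖e‖ = 1)
    {η : ℝ} (hη : 0 < η) :
    ∀ᶠ x in smoothingFilter (radialState e r w 0), ∃ s, |s - T| < η ∧
      radialMom (smoothFamily x s) = 0 ∧
      ‖‖(smoothFamily x s).2‖⁻¹ • (smoothFamily x s).2 - -e‖ < η ∧
      ∀ t ∈ Icc 0 s, t ≤ 2 * T → ‖(smoothFamily x t).1 - transmitted T r t • e‖ < η := by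
  have hT := h.pos
  have hRT : transmitted T r T = 0 := by rw [transmitted, if_pos le_rfl, h.r_collision]
  obtain ⟨ω, hω, hR⟩ : ∃ ω > 0, ∀ t ∈ Icc 0 (2 * T), |t - T| < ω → |transmitted T r t| < η / 2 := by
    have := Metric.continuousOn_iff.1 h.continuousOn_transmitted T ⟨hT.le, by linarith⟩ (η / 2)
      (half_pos hη)
    simpa only [Real.dist_eq, hRT, sub_zero, gt_iff_lt, ← and_imp, and_comm] using this
  set κ := min η ω with hκ
  have hκ0 : 0 < κ := lt_min hη hω
  have hw2 : Tendsto (fun t => w t ^ 2) (𝓝[<] T) atTop := by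
    simpa [Function.comp_def] using
      ((tendsto_pow_atTop (α := ℝ) two_ne_zero).comp tendsto_abs_atBot_atTop).comp h.tendsto_w
  have hdir : Tendsto (fun t => Real.pi / 2 / (w t ^ 2 - 1)) (𝓝[<] T) (𝓝 0) :=
    Tendsto.const_div_atTop (tendsto_atTop_add_const_right _ (-1) hw2) _
  -- `t₁` is so close to `T` that the radius is tiny and the speed huge. Regular convergence is used
  -- up to `t₁`. From there the pericentre comes within time `2‖u‖ < κ`, and meanwhile both paths
  -- stay within `η/2` of the origin.
  obtain ⟨t₁, ⟨⟨⟨hw1, hr1⟩, hd1⟩, hw0⟩, ht1⟩ := ((((hw2.eventually_gt_atTop 2).and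
    (h.tendsto_r.eventually (gt_mem_nhds (by positivity : 0 < min (κ / 2) (η / 2))))).and
    (hdir.eventually (gt_mem_nhds hη))).and (h.tendsto_w.eventually_lt_atBot 0)).and
    (Ioo_mem_nhdsLT (max_lt hT (by linarith : T - κ < T))) |>.exists
  have ht0 : 0 < t₁ := (le_max_left _ _).trans_lt ht1.1
  have htκ : T - κ < t₁ := (le_max_right _ _).trans_lt ht1.1
  have hr0 := h.r_pos t₁ ⟨ht0.le, ht1.2⟩
  have hconv := h.tendstoUniformlyOn_smoothFamily he ht0.le ht1.2
  have hlim := hconv.tendsto_at (x := t₁) ⟨ht0.le, le_rfl⟩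
  set z₁ := radialState e r w t₁ with hz₁
  have hz1 : ‖z₁.1‖ = r t₁ := by
    rw [hz₁, radialState, norm_smul, he, mul_one, Real.norm_of_nonneg hr0.le]
  have hz2 : ‖z₁.2‖ = -w t₁ := by
    rw [hz₁, radialState, norm_smul, he, mul_one, Real.norm_of_nonpos hw0.le]
  have hz2' : z₁.2 ≠ 0 := norm_ne_zero_iff.1 (by rw [hz2]; linarith)
  have hmom : radialMom z₁ < 0 := by
    rw [hz₁, radialState, radialMom, real_inner_smul_left, real_inner_smul_right,
      real_inner_self_eq_norm_sq, he]
    nlinarith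
  have hmom_c : Continuous radialMom := continuous_fst.inner continuous_snd
  have c1 : ∀ᶠ z in 𝓝 z₁, radialMom z < 0 := hmom_c.continuousAt.eventually_lt_const hmom
  have c2 : ∀ᶠ z in 𝓝 z₁, 2 < ‖z.2‖ ^ 2 := by
    have hc : ContinuousAt (fun z : Plane × Plane => ‖z.2‖ ^ 2) z₁ := by fun_prop
    exact hc.eventually_const_lt (by beta_reduce; rwa [hz2, neg_sq])
  have c3 : ∀ᶠ z in 𝓝 z₁, ‖z.1‖ < min (κ / 2) (η / 2) := by
    have hc : ContinuousAt (fun z : Plane × Plane => ‖z.1‖) z₁ := by fun_prop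
    exact hc.eventually_lt_const (by beta_reduce; rwa [hz1])
  have c4 : ∀ᶠ z in 𝓝 z₁, Real.pi / 2 / (‖z.2‖ ^ 2 - 1) + ‖‖z.2‖⁻¹ • z.2 - -e‖ < η := by
    have h1 : ‖z₁.2‖ ^ 2 - 1 ≠ 0 := by rw [hz2, neg_sq]; linarith
    have h2 : ‖z₁.2‖ ≠ 0 := norm_ne_zero_iff.2 hz2'
    have hc : ContinuousAt (fun z : Plane × Plane =>
        Real.pi / 2 / (‖z.2‖ ^ 2 - 1) + ‖‖z.2‖⁻¹ • z.2 - -e‖) z₁ := by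
      fun_prop (disch := assumption)
    refine hc.eventually_lt_const ?_
    beta_reduce
    rw [hz2, neg_sq, hz₁, radialState, smul_smul, inv_neg, neg_mul, inv_mul_cancel₀ hw0.ne,
      neg_one_smul, sub_self, norm_zero, add_zero]
    exact hd1
  filter_upwards [hlim.eventually c1, hlim.eventually c2, hlim.eventually c3, hlim.eventually c4,
    eventually_smoothing_pos _, Metric.tendstoUniformlyOn_iff.1 hconv η hη] with x m1 m2 m3 m4 hε m5
  obtain ⟨s, hs0, hs1, hs2, hs3⟩ := exists_pericentre_time hε m1 m2.le
  have hnorm := norm_le_of_radialMom_nonpos hε (τ := s) fun t ht => (hs3 t ht).le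
  have hadd : ∀ t, smoothFlow x.1 (smoothFamily x t₁) t = smoothFamily x (t₁ + t) := fun t =>
    (smoothFlow_add hε x.2 t₁ t).symm
  have hdirs := norm_direction_sub_le hε m2.le hs0 hs2 hs3
  simp only [hadd] at hs2 hnorm hdirs
  have m3' := m3.trans_le (min_le_left _ _)
  have m3'' := m3.trans_le (min_le_right _ _)
  have hnear : ∀ t, 0 ≤ t → t ≤ s → |t₁ + t - T| < κ := fun t ht hts => by
    rw [abs_lt]; constructor <;> linarith [ht1.2]
  refine ⟨t₁ + s, (hnear s hs0.le le_rfl).trans_le (min_le_left _ _), hs2, ?_, fun t ht htT => ?_⟩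
  · calc _ ≤ _ := norm_sub_le_norm_sub_add_norm_sub _ (‖(smoothFamily x t₁).2‖⁻¹ •
          (smoothFamily x t₁).2) _
      _ ≤ _ := by gcongr
      _ < η := m4
  · rcases le_total t t₁ with htt | htt
    · have h1 := m5 t ⟨ht.1, htt⟩
      rw [dist_comm, dist_eq_norm] at h1
      have h2 : transmitted T r t • e = (radialState e r w t).1 := by
        rw [transmitted, if_pos (htt.trans ht1.2.le), radialState]
      rw [h2]
      exact (norm_fst_le (smoothFamily x t - radialState e r w t)).trans_lt h1
    · have h1 := hnorm (t - t₁) ⟨by linarith, by linarith [ht.2]⟩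
      have h2 := hnear (t - t₁) (by linarith) (by linarith [ht.2])
      rw [add_sub_cancel] at h1 h2
      have h3 := hR t ⟨ht.1, htT⟩ (h2.trans_le (min_le_right _ _))
      have h4 : ‖transmitted T r t • e‖ < η / 2 := by
        rwa [norm_smul, he, mul_one, Real.norm_eq_abs]
      calc _ ≤ ‖(smoothFamily x t).1‖ + ‖transmitted T r t • e‖ := norm_sub_le _ _
        _ < η := by linarith [h1.1]

end IsRadialCollision

/-- The paths of the smoothed problems converge to `w`, uniformly on `[0, τ]`, when the smoothing
parameter tends to `0⁺` and the initial datum to `μ`. -/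
def HasSmoothLimit (μ : Plane × Plane) (τ : ℝ) (w : ℝ → Plane) : Prop :=
  TendstoUniformlyOn (fun x t => (smoothFamily x t).1) w (smoothingFilter μ) (Icc 0 τ)

theorem norm_reflection_smul_sub_le {E : Type*} [NormedAddCommGroup E] [InnerProductSpace ℝ E]
    (v e : E) (c : ℝ) :
    ‖(ℝ ∙ v).reflection (c • e) - c • e‖ ≤ |c| * (2 * ‖‖v‖⁻¹ • v - -e‖) := by
  have h : (ℝ ∙ v).reflection (c • e) - c • e = -c • ((ℝ ∙ v).reflection (-e) - -e) := by
    rw [map_smul, map_neg]; module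
  rw [h, norm_smul, norm_neg, Real.norm_eq_abs]
  gcongr
  exact norm_reflection_sub_le v (-e)

namespace IsRadialCollision

variable {T : ℝ} {r w : ℝ → ℝ}

/-- After the pericentre time `s`, `u(t) = -Q u(2s - t)` with `Q` nearly the identity on the line of
`e`. Stopping at `3T/2` leaves room for `2s - t ≥ 0` although `s` is only close to `T`. -/
theorem hasSmoothLimit_transmitted (h : IsRadialCollision T r w) {e : Plane} (he : ‖e‖ = 1) :
    HasSmoothLimit (radialState e r w 0) (3 / 2 * T) fun t => transmitted T r t • e := by
  have hT := h.pos
  rw [HasSmoothLimit, Metric.tendstoUniformlyOn_iff]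
  intro η hη
  obtain ⟨M, hM⟩ := isCompact_Icc.exists_bound_of_continuousOn h.continuousOn_transmitted
  have hM0 : 0 ≤ M := (norm_nonneg _).trans (hM 0 ⟨le_rfl, by linarith⟩)
  obtain ⟨ω, hω, hR⟩ := Metric.uniformContinuousOn_iff.1
    (isCompact_Icc.uniformContinuousOn_of_continuous h.continuousOn_transmitted) (η / 3)
    (by positivity)
  -- The four bounds serve, in order, the position error at the reflected time, the defect of `Q` on
  -- a path of size at most `M`, the shift `2|s - T| < ω`, and `2s - 3T/2 ≥ 0`.
  set η' := min (min (η / 3) (η / (6 * (M + 1)))) (min (ω / 2) (T / 8)) with hη'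
  have hη'0 : 0 < η' := by positivity
  have e1 : η' ≤ η / 3 := (min_le_left _ _).trans (min_le_left _ _)
  have e2 : η' ≤ η / (6 * (M + 1)) := (min_le_left _ _).trans (min_le_right _ _)
  have e3 : η' ≤ ω / 2 := (min_le_right _ _).trans (min_le_left _ _)
  have e4 : η' ≤ T / 8 := (min_le_right _ _).trans (min_le_right _ _)
  filter_upwards [h.eventually_exists_pericentre he hη'0, eventually_smoothing_pos _]
    with x ⟨s, hsT, hs0, hdir, hclose⟩ hε t ht
  rw [dist_comm, dist_eq_norm]
  obtain ⟨hs1, hs2⟩ := abs_lt.1 hsT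
  rcases le_total t s with hts | hts
  · exact (hclose t ⟨ht.1, hts⟩ (by linarith [ht.2])).trans_le (by linarith)
  · have hrefl := smoothFlow_add_reflection hε hs0 (t - s)
    rw [add_sub_cancel] at hrefl
    set Q := (ℝ ∙ (smoothFamily x s).2).reflection with hQ
    set σ := s - (t - s) with hσ
    have hσ0 : σ ∈ Icc 0 s := ⟨by linarith [ht.2], by linarith⟩
    have hσT : σ ≤ 2 * T := by linarith [hσ0.2]
    have hu : (smoothFamily x t).1 = -Q (smoothFamily x σ).1 := congrArg Prod.fst hrefl
    have d1 : ‖Q ((smoothFamily x σ).1 - transmitted T r σ • e)‖ < η / 3 := by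
      rw [LinearIsometryEquiv.norm_map]
      exact (hclose σ hσ0 hσT).trans_le e1
    have d2 : ‖Q (transmitted T r σ • e) - transmitted T r σ • e‖ ≤ η / 3 := by
      refine (norm_reflection_smul_sub_le _ _ _).trans ?_
      have h1 := hM σ ⟨hσ0.1, hσT⟩
      rw [Real.norm_eq_abs] at h1
      calc _ ≤ M * (2 * (η / (6 * (M + 1)))) := by
            gcongr
            exact hdir.le.trans e2
        _ = η / 3 * (M / (M + 1)) := by field_simp; ring
        _ ≤ η / 3 * 1 := by
            gcongr
            rw [div_le_one (by positivity)]
            linarith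
        _ = η / 3 := mul_one _
    have d3 : ‖(transmitted T r σ + transmitted T r t) • e‖ < η / 3 := by
      rw [norm_smul, he, mul_one]
      have h1 := hR σ ⟨hσ0.1, hσT⟩ (2 * T - t) ⟨by linarith [ht.2], by linarith [ht.1]⟩ (by
        rw [Real.dist_eq, hσ, abs_lt]
        constructor <;> linarith)
      rwa [h.transmitted_reflect, Real.dist_eq, sub_neg_eq_add] at h1
    have d4 : (smoothFamily x t).1 - transmitted T r t • e
        = -Q ((smoothFamily x σ).1 - transmitted T r σ • e)
          - (Q (transmitted T r σ • e) - transmitted T r σ • e)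
          - (transmitted T r σ + transmitted T r t) • e := by
      rw [hu, map_sub]; module
    rw [d4]
    calc _ ≤ _ := norm_sub_le _ _
      _ ≤ _ := add_le_add_left (norm_sub_le _ _) _
      _ < η := by rw [norm_neg]; linarith

/-- A restart needs the velocity too, which blows up at `T`. At `3T/2` the reflected time `2s -
3T/2` is close to `T/2`, inside `[0, 3T/4]`, where phase space convergence is already known. -/
theorem tendsto_smoothFamily_after (h : IsRadialCollision T r w) {e : Plane} (he : ‖e‖ = 1) :
    Tendsto (fun x => smoothFamily x (3 / 2 * T)) (smoothingFilter (radialState e r w 0))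
      (𝓝 (-r (T / 2) • e, w (T / 2) • e)) := by
  have hT := h.pos
  refine (Prod.tendsto_iff _ _).2 ⟨?_, ?_⟩
  · have h1 := (h.hasSmoothLimit_transmitted he).tendsto_at (x := 3 / 2 * T)
      ⟨by linarith, le_rfl⟩
    have h2 : 2 * T - 3 / 2 * T = T / 2 := by ring
    rwa [transmitted, if_neg (by linarith), h2] at h1
  · rw [Metric.tendsto_nhds]
    intro η hη
    obtain ⟨ω, hω, hw⟩ := Metric.continuousAt_iff.1
      (h.hasDerivAt_w (T / 2) ⟨by linarith, by linarith⟩).continuousAt (η / 3) (by positivity)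
    set M := |w (T / 2)| with hM
    set η' := min (η / (6 * (M + 1))) (min (ω / 2) (T / 8)) with hη'
    have hη'0 : 0 < η' := by positivity
    have e2 : η' ≤ η / (6 * (M + 1)) := min_le_left _ _
    have e3 : η' ≤ ω / 2 := (min_le_right _ _).trans (min_le_left _ _)
    have e4 : η' ≤ T / 8 := (min_le_right _ _).trans (min_le_right _ _)
    have hconv := Metric.tendstoUniformlyOn_iff.1 (h.tendstoUniformlyOn_smoothFamily he
      (by linarith : 0 ≤ 3 / 4 * T) (by linarith)) (η / 3) (by positivity)
    filter_upwards [h.eventually_exists_pericentre he hη'0, eventually_smoothing_pos _, hconv]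
      with x ⟨s, hsT, hs0, hdir, _⟩ hε hc
    obtain ⟨hs1, hs2⟩ := abs_lt.1 hsT
    have hrefl := smoothFlow_add_reflection hε hs0 (3 / 2 * T - s)
    rw [add_sub_cancel] at hrefl
    set Q := (ℝ ∙ (smoothFamily x s).2).reflection with hQ
    set σ := s - (3 / 2 * T - s) with hσ
    have hu : (smoothFamily x (3 / 2 * T)).2 = Q (smoothFamily x σ).2 := congrArg Prod.snd hrefl
    have d1 : ‖Q ((smoothFamily x σ).2 - w σ • e)‖ < η / 3 := by
      rw [LinearIsometryEquiv.norm_map]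
      have h1 := hc σ ⟨by linarith, by linarith⟩
      rw [dist_comm, dist_eq_norm] at h1
      exact (norm_snd_le (smoothFamily x σ - radialState e r w σ)).trans_lt h1
    have d2 : ‖Q ((w σ - w (T / 2)) • e)‖ < η / 3 := by
      rw [LinearIsometryEquiv.norm_map, norm_smul, he, mul_one]
      refine hw ?_
      rw [Real.dist_eq, abs_lt]
      constructor <;> linarith
    have d3 : ‖Q (w (T / 2) • e) - w (T / 2) • e‖ ≤ η / 3 := by
      refine (norm_reflection_smul_sub_le _ _ _).trans ?_
      calc _ ≤ M * (2 * (η / (6 * (M + 1)))) := by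
            gcongr
            exact hdir.le.trans e2
        _ = η / 3 * (M / (M + 1)) := by field_simp; ring
        _ ≤ η / 3 * 1 := by
            gcongr
            rw [div_le_one (by positivity)]
            linarith
        _ = η / 3 := mul_one _
    have d4 : (smoothFamily x (3 / 2 * T)).2 - w (T / 2) • e
        = Q ((smoothFamily x σ).2 - w σ • e) + Q ((w σ - w (T / 2)) • e)
          + (Q (w (T / 2) • e) - w (T / 2) • e) := by
      rw [hu, map_sub, sub_smul, map_sub]; module
    rw [dist_eq_norm, d4]
    calc _ ≤ _ := norm_add₃_le
      _ < η := by linarith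

/-- The outgoing half is the incoming one reversed in time and negated in position, so it is a
regular trajectory, here taken from `3T/2` to `2T`. -/
theorem isRegularOn_after (h : IsRadialCollision T r w) {e : Plane} (he : ‖e‖ = 1) :
    IsRegularOn (T / 2) fun t => (-r (T / 2 - t) • e, w (T / 2 - t) • e) := by
  intro t ht
  have hT := h.pos
  have ht' : T / 2 - t ∈ Ico 0 T := ⟨by linarith [ht.2], by linarith [ht.1]⟩
  have hr := h.r_pos _ ht'
  refine ⟨smul_ne_zero (neg_ne_zero.2 hr.ne') (norm_ne_zero_iff.1 (by rw [he]; exact one_ne_zero)),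
    ?_⟩
  have h1 := ((h.hasDerivAt_r _ ht').comp_const_sub (T / 2) t).neg.smul_const e
  have h2 := ((h.hasDerivAt_w _ ht').comp_const_sub (T / 2) t).smul_const e
  refine ((h1.prodMk h2).congr_deriv ?_).hasDerivWithinAt
  rw [phaseField_smul he (neg_ne_zero.2 hr.ne'), neg_neg, inv_neg]

end IsRadialCollision

/-! ### Concatenation -/

theorem tendsto_smoothingFilter {μ μ' : Plane × Plane} {s : ℝ}
    (h : Tendsto (fun x => smoothFamily x s) (smoothingFilter μ) (𝓝 μ')) :
    Tendsto (fun x => (x.1, smoothFamily x s)) (smoothingFilter μ) (smoothingFilter μ') :=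
  tendsto_fst.prodMk h

theorem smoothFamily_add {x : ℝ × (Plane × Plane)} (hx : 0 < x.1) (s t : ℝ) :
    smoothFamily x (s + t) = smoothFamily (x.1, smoothFamily x s) t :=
  smoothFlow_add hx x.2 s t

theorem tendsto_smoothFamily_add {μ μ' z : Plane × Plane} {s t : ℝ}
    (h : Tendsto (fun x => smoothFamily x s) (smoothingFilter μ) (𝓝 μ'))
    (h' : Tendsto (fun x => smoothFamily x t) (smoothingFilter μ') (𝓝 z)) :
    Tendsto (fun x => smoothFamily x (s + t)) (smoothingFilter μ) (𝓝 z) := by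
  refine (h'.comp (tendsto_smoothingFilter h)).congr' ?_
  filter_upwards [eventually_smoothing_pos μ] with x hx
  exact (smoothFamily_add hx s t).symm

theorem HasSmoothLimit.mono {μ : Plane × Plane} {σ τ : ℝ} {w : ℝ → Plane}
    (h : HasSmoothLimit μ τ w) (hστ : σ ≤ τ) : HasSmoothLimit μ σ w :=
  TendstoUniformlyOn.mono h (Icc_subset_Icc_right hστ)

/-- The datum at the restart is the smoothed phase point at time `s`, which depends on `ε`.
Independence of the limits in `ε` and `ν` is what allows the composition. -/
theorem HasSmoothLimit.add {μ μ' : Plane × Plane} {s τ : ℝ} {w y : ℝ → Plane}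
    (h : HasSmoothLimit μ s w)
    (hs : Tendsto (fun x => smoothFamily x s) (smoothingFilter μ) (𝓝 μ'))
    (h' : HasSmoothLimit μ' τ y) :
    HasSmoothLimit μ (s + τ) fun t => if t ≤ s then w t else y (t - s) := by
  rw [HasSmoothLimit, Metric.tendstoUniformlyOn_iff] at *
  intro η hη
  filter_upwards [h η hη, (tendsto_smoothingFilter hs).eventually (h' η hη),
    eventually_smoothing_pos μ] with x h1 h2 hx t ht
  split_ifs with hts
  · exact h1 t ⟨ht.1, hts⟩
  · have h3 := h2 (t - s) ⟨by linarith, by linarith [ht.2]⟩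
    rwa [← smoothFamily_add hx, add_sub_cancel] at h3

theorem IsRegularOn.hasSmoothLimit {τ : ℝ} (hτ : 0 ≤ τ) {z : ℝ → Plane × Plane}
    (h : IsRegularOn τ z) : HasSmoothLimit (z 0) τ fun t => (z t).1 := by
  have := h.tendstoUniformlyOn_smoothFamily hτ
  rw [HasSmoothLimit, Metric.tendstoUniformlyOn_iff]
  rw [Metric.tendstoUniformlyOn_iff] at this
  intro η hη
  filter_upwards [this η hη] with x hx t ht
  exact (le_max_left _ _).trans_lt (hx t ht)

theorem HasSmoothLimit.congr {μ : Plane × Plane} {τ : ℝ} {w y : ℝ → Plane}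
    (h : HasSmoothLimit μ τ w) (hwy : EqOn w y (Icc 0 τ)) : HasSmoothLimit μ τ y :=
  TendstoUniformlyOn.congr_right h hwy

namespace IsRadialCollision

variable {T : ℝ} {r w : ℝ → ℝ}

theorem hasSmoothLimit (h : IsRadialCollision T r w) {e : Plane} (he : ‖e‖ = 1) :
    HasSmoothLimit (r 0 • e, w 0 • e) (2 * T) (fun t => transmitted T r t • e) ∧
    Tendsto (fun x => smoothFamily x (2 * T)) (smoothingFilter (r 0 • e, w 0 • e))
      (𝓝 (-(r 0 • e), w 0 • e)) := by
  have hT := h.pos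
  have h1 := h.tendsto_smoothFamily_after he
  have h2 := h.isRegularOn_after he
  have h3 : 3 / 2 * T + T / 2 = 2 * T := by ring
  have h4 : (0 : ℝ) ≤ T / 2 := by linarith
  have h5 := h2.hasSmoothLimit h4
  have h6 := (h2.tendstoUniformlyOn_smoothFamily h4).tendsto_at (x := T / 2) ⟨h4, le_rfl⟩
  simp only [sub_zero, sub_self] at h5 h6
  constructor
  · have h7 := (h.hasSmoothLimit_transmitted he).add h1 h5
    rw [h3] at h7
    refine h7.congr fun t ht => ?_
    simp only
    split_ifs with hts
    · rfl
    · rw [transmitted, if_neg (by linarith)]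
      congr 3
      ring
  · have h7 := tendsto_smoothFamily_add h1 h6
    rwa [h3, neg_smul] at h7

end IsRadialCollision

/-! ### The extended flow -/

/-- The extended flow: the limit of the smoothed flows. -/
def extendedFlow (μ : Plane × Plane) (t : ℝ) : Plane :=
  limUnder (smoothingFilter μ) fun x => (smoothFamily x t).1

theorem HasSmoothLimit.eqOn_extendedFlow {μ : Plane × Plane} {τ : ℝ} {w : ℝ → Plane}
    (h : HasSmoothLimit μ τ w) : EqOn (extendedFlow μ) w (Icc 0 τ) := fun _ ht =>
  (TendstoUniformlyOn.tendsto_at h ht).limUnder_eq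

theorem HasSmoothLimit.extendedFlow {μ : Plane × Plane} {τ : ℝ} {w : ℝ → Plane}
    (h : HasSmoothLimit μ τ w) : HasSmoothLimit μ τ (extendedFlow μ) :=
  h.congr h.eqOn_extendedFlow.symm

theorem angMom_neg_fst (ν : Plane × Plane) : angMom (-ν.1, ν.2) = -angMom ν := by
  simp [angMom]; ring

/-- Data with angular momentum zero are transmitted through the collision. -/
theorem exists_hasSmoothLimit_of_angMom_eq_zero {ν : Plane × Plane} (hq : ν.1 ≠ 0)
    (h : angMom ν = 0) : ∃ T > 0, (∃ w, HasSmoothLimit ν T w) ∧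
      Tendsto (fun x => smoothFamily x T) (smoothingFilter ν) (𝓝 (-ν.1, ν.2)) := by
  obtain ⟨e, T, r, w, he, hrw, hν⟩ := exists_isRadialCollision_of_angMom_eq_zero hq h
  have h1 := hrw.hasSmoothLimit he
  rw [hν]
  exact ⟨2 * T, by linarith [hrw.pos], ⟨_, h1.1⟩, h1.2⟩

theorem exists_hasSmoothLimit {ν : Plane × Plane} (hq : ν.1 ≠ 0) {τ : ℝ} (hτ : 0 ≤ τ) :
    ∃ w, HasSmoothLimit ν τ w := by
  by_cases h : angMom ν = 0
  · obtain ⟨T, hT, ⟨w, hw⟩, hlim⟩ := exists_hasSmoothLimit_of_angMom_eq_zero hq h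
    obtain ⟨T', hT', ⟨w', hw'⟩, hlim'⟩ := exists_hasSmoothLimit_of_angMom_eq_zero
      (ν := (-ν.1, ν.2)) (neg_ne_zero.2 hq) (by rw [angMom_neg_fst, h, neg_zero])
    simp only [neg_neg, Prod.mk.eta] at hlim'
    set c := min T T' with hc
    have hc0 : 0 < c := lt_min hT hT'
    -- Successive transmissions alternate between `(q, p)` and `(-q, p)`, so only two passage times
    -- occur and collisions cannot accumulate. Each induction step gains at least `c`.
    have key : ∀ n : ℕ, (∃ w, HasSmoothLimit ν (n * c) w) ∧
        ∃ w, HasSmoothLimit (-ν.1, ν.2) (n * c) w := by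
      intro n
      induction n with
      | zero =>
        simp only [Nat.cast_zero, zero_mul]
        exact ⟨⟨w, hw.mono hT.le⟩, ⟨w', hw'.mono hT'.le⟩⟩
      | succ n ih =>
        obtain ⟨⟨y, hy⟩, ⟨y', hy'⟩⟩ := ih
        have e1 : ((n + 1 : ℕ) : ℝ) * c ≤ T + n * c := by
          push_cast
          linarith [min_le_left T T']
        have e2 : ((n + 1 : ℕ) : ℝ) * c ≤ T' + n * c := by
          push_cast
          linarith [min_le_right T T']
        exact ⟨⟨_, (hw.add hlim hy').mono e1⟩, ⟨_, (hw'.add hlim' hy).mono e2⟩⟩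
    obtain ⟨n, hn⟩ := exists_nat_ge (τ / c)
    rw [div_le_iff₀ hc0] at hn
    exact ⟨_, (key n).1.choose_spec.mono hn⟩
  · obtain ⟨z, hz0, hz⟩ := exists_isRegularOn_of_angMom_ne_zero h
    have := (hz τ).hasSmoothLimit hτ
    rw [hz0] at this
    exact ⟨_, this⟩

theorem hasSmoothLimit_extendedFlow {ν : Plane × Plane} (hq : ν.1 ≠ 0) {τ : ℝ} (hτ : 0 ≤ τ) :
    HasSmoothLimit ν τ (extendedFlow ν) :=
  (exists_hasSmoothLimit hq hτ).choose_spec.extendedFlow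

theorem continuousOn_extendedFlow {ν : Plane × Plane} (hq : ν.1 ≠ 0) :
    ContinuousOn (extendedFlow ν) (Ici 0) := by
  intro t ht
  have ht : 0 ≤ t := ht
  have h := hasSmoothLimit_extendedFlow hq (by linarith : 0 ≤ t + 1)
  have h1 : ContinuousOn (extendedFlow ν) (Icc 0 (t + 1)) := by
    refine TendstoUniformlyOn.continuousOn h (Eventually.frequently ?_)
    filter_upwards [eventually_smoothing_pos ν] with x hx
    exact (continuous_fst.comp (continuous_smoothFlow hx x.2)).continuousOn
  refine (h1 t ⟨ht, by linarith⟩).mono_of_mem_nhdsWithin ?_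
  filter_upwards [self_mem_nhdsWithin, mem_nhdsWithin_of_mem_nhds (Iio_mem_nhds (lt_add_one t))]
    with s hs hs' using ⟨hs, le_of_lt hs'⟩

/-- Letting `ε → 0` at fixed `ν` close to `μ` in the joint estimate compares the two limits. -/
theorem tendstoUniformlyOn_extendedFlow {μ : Plane × Plane} (hq : μ.1 ≠ 0) {τ : ℝ} (hτ : 0 ≤ τ) :
    TendstoUniformlyOn extendedFlow (extendedFlow μ) (𝓝 μ) (Icc 0 τ) := by
  rw [Metric.tendstoUniformlyOn_iff]
  intro η hη
  have h := Metric.tendstoUniformlyOn_iff.1 (hasSmoothLimit_extendedFlow hq hτ) (η / 2)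
    (half_pos hη)
  obtain ⟨p, hp, p', hp', hpp⟩ := eventually_prod_iff.1 h
  have hne : ∀ᶠ ν : Plane × Plane in 𝓝 μ, ν.1 ≠ 0 := continuous_fst.continuousAt.eventually_ne hq
  filter_upwards [hp', hne] with ν hν hν0 t ht
  have h1 := TendstoUniformlyOn.tendsto_at (hasSmoothLimit_extendedFlow hν0 hτ) ht
  have h2 : Tendsto (fun ε : ℝ => (ε, ν)) (𝓝[>] 0) (smoothingFilter ν) :=
    tendsto_id.prodMk tendsto_const_nhds
  have h3 := le_of_tendsto ((tendsto_const_nhds (x := extendedFlow μ t)).dist (h1.comp h2))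
    (hp.mono fun ε hε => (hpp hε hν t ht).le)
  linarith

theorem mem_collisionData_of_angMom_eq_zero {ν : Plane × Plane} (hq : ν.1 ≠ 0)
    (h : angMom ν = 0) : ν ∈ collisionData logPotential ⊤ := by
  obtain ⟨e, T, r, w, he, hrw, hν⟩ := exists_isRadialCollision_of_angMom_eq_zero hq h
  exact ⟨T, _, hν ▸ hrw.isCollisionSolution he⟩

theorem isStrongRegularization_extendedFlow :
    IsStrongRegularization logPotential ⊤ extendedFlow where
  path ν hν := by
    refine ⟨?_, continuousOn_extendedFlow hν.1⟩
    have h := TendstoUniformlyOn.tendsto_at (hasSmoothLimit_extendedFlow hν.1 le_rfl)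
      (x := 0) ⟨le_rfl, le_rfl⟩
    have h2 : Tendsto (fun x : ℝ × (Plane × Plane) => (smoothFamily x 0).1) (smoothingFilter ν)
        (𝓝 ν.1) := by
      simp only [smoothFamily, smoothFlow_zero]
      exact (continuous_fst.tendsto ν).comp tendsto_snd
    exact tendsto_nhds_unique h h2
  classical ν hν hS τ hτ _ := by
    have hℓ : angMom ν ≠ 0 := fun h => hS (mem_collisionData_of_angMom_eq_zero hν.1 h)
    obtain ⟨z, hz0, hz⟩ := exists_isRegularOn_of_angMom_ne_zero hℓ
    have h1 := (hz τ).hasSmoothLimit hτ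
    rw [hz0] at h1
    have h2 := h1.eqOn_extendedFlow
    obtain ⟨⟨h3, v, hv0, hv⟩, hne⟩ := (hz τ).isClassicalSolutionOn
    rw [hz0] at h3 hv0
    refine ⟨⟨(h2 ⟨le_rfl, hτ⟩).trans h3, v, hv0, fun t ht => ?_⟩, fun t ht => ?_⟩
    · rw [h2 ht]
      exact ⟨(hv t ht).1.congr h2 (h2 ht), (hv t ht).2⟩
    · rw [h2 ht]
      exact hne t ht
  limit μ hμ τ hτ _ η hη := by
    obtain ⟨T, u, hu⟩ := hμ
    have h := Metric.tendstoUniformlyOn_iff.1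
      (hasSmoothLimit_extendedFlow hu.fst_ne_zero hτ) η hη
    have hpos := eventually_smoothing_pos μ
    rw [smoothingFilter] at h hpos
    filter_upwards [h, hpos] with x hx hε
    refine ⟨⟨_, isSolutionOn_smoothFlow hε x.2 _⟩, fun u hu t ht => ?_⟩
    rw [hu.eqOn_smoothFlow hε ht, dist_comm]
    exact hx t ht
  continuous μ hμ τ hτ _ :=
    fun V hV => nhdsWithin_le_nhds (tendstoUniformlyOn_extendedFlow hμ.1 hτ V hV)

theorem IsCollisionSolution.extendedFlow {ν : Plane × Plane} {T : ℝ} {u : ℝ → Plane}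
    (h : IsCollisionSolution logPotential ⊤ ν T u) :
    IsTransmissionSolution u T (extendedFlow ν) ∧
      ∀ t, 0 ≤ t → OneCentre.extendedFlow ν (2 * T + t) = OneCentre.extendedFlow (-ν.1, ν.2) t := by
  obtain ⟨e, r, w, he, hrw, rfl, hu⟩ := h.exists_radial
  have hT := hrw.pos
  obtain ⟨h1, h2⟩ := hrw.hasSmoothLimit he
  have h3 := h1.eqOn_extendedFlow
  refine ⟨⟨fun t ht => ?_, fun t ht => ?_⟩, fun t ht => ?_⟩
  · rw [h3 ⟨ht.1, by linarith [ht.2]⟩, hu t ht]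
    simp only [transmitted, if_pos ht.2]
  · rw [h3 ⟨by linarith [ht.1], ht.2⟩, hu _ ⟨by linarith [ht.2], by linarith [ht.1]⟩]
    have h4 := hrw.transmitted_reflect t
    rw [transmitted, if_pos (by linarith [ht.1])] at h4
    simp only [h4, neg_smul, neg_neg]
  · have hq : (-(r 0 • e), w 0 • e).1 ≠ 0 := neg_ne_zero.2 h.fst_ne_zero
    have h4 := hasSmoothLimit_extendedFlow hq ht
    have h5 := (h1.add h2 h4).eqOn_extendedFlow (x := 2 * T + t) ⟨by linarith, le_rfl⟩
    rw [h5]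
    split_ifs with h6
    -- At the junction the concatenation takes its left branch; the phase limit at `2T` identifies
    -- the value with `-q`.
    · have h7 : t = 0 := by linarith
      subst h7
      have h8 := (continuous_fst.tendsto _).comp h2
      have h9 := TendstoUniformlyOn.tendsto_at h1 (x := 2 * T) ⟨by linarith, le_rfl⟩
      have h10 := isStrongRegularization_extendedFlow.path _
        (⟨hq, le_top⟩ : (-(r 0 • e), w 0 • e) ∈ initialData ⊤)
      rw [add_zero, h10.1]
      exact tendsto_nhds_unique h9 h8
    · rw [add_sub_cancel_left]

end OneCentre

end

theorem mainTheorem2 :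
    OneCentre.validRadius OneCentre.logPotential = ⊤ ∧
    ∃ Φ : OneCentre.Plane × OneCentre.Plane → ℝ → OneCentre.Plane,
      OneCentre.IsStrongRegularization OneCentre.logPotential
        (OneCentre.validRadius OneCentre.logPotential) Φ ∧
      ∀ (ν : OneCentre.Plane × OneCentre.Plane) (T₀ : ℝ) (u : ℝ → OneCentre.Plane),
        OneCentre.IsCollisionSolution OneCentre.logPotential
          (OneCentre.validRadius OneCentre.logPotential) ν T₀ u →
        OneCentre.IsTransmissionSolution u T₀ (Φ ν) ∧
        ∀ t : ℝ, 0 ≤ t → Φ ν (2 * T₀ + t) = Φ (-ν.1, ν.2) t := by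
  rw [OneCentre.validRadius_logPotential]
  exact ⟨rfl, OneCentre.extendedFlow, OneCentre.isStrongRegularization_extendedFlow,
    fun _ _ _ h => h.extendedFlow⟩
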